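/- Let $\theta>0$, let $X=(X_i)_{i\ge1}$ be a random element of $\{x_1\ge x_2\ge\dots\ge0,\ \sum_i x_i=1\}$ with the Poisson–Dirichlet distribution $\mathrm{PD}(\theta)$, and let $V$ be a $(0,\infty)$-valued random variable with law $\rho$, independent of $X$. Put $\xi=\sum_i \mathbf 1_{\{VX_i>0\}}\delta_{VX_i}$, a point process on $(0,\infty)$, i.e. a random element of the space $\mathcal N$ of $\mathbb Z_+$-valued Radon measures on $(0,\infty)$. For $k\ge1$ let $\xi^{[k]}$ be the sum of $\delta_{(VX_{i_1},\dots,VX_{i_k})}$ over $k$-tuples of distinct indices with $VX_{i_1},\dots,VX_{i_k}>0$. The $k$-th correlation measure $q_k$ of $\xi$ is the mean measure of $\xi^{[k]}$, and its density with respect to Lebesgue measure on $(0,\infty)^k$ is the $k$-th correlation function. A measurable family $(P_z)_{z\in(0,\infty)^k}$ of probability measures on $\mathcal N$ is a family of $k$-th order reduced Palm distributions of $\xi$ if, for all measurable $G\ge0$ on $(0,\infty)^k\times\mathcal N$, $$E\Big[\int \xi^{[k]}(dz)\,G(z,\xi)\Big]=\int q_k(dz)\int_{\mathcal N}P_z(d\eta)\,G(z,\eta+\delta_{z_1}+\cdots+\delta_{z_k}).$$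 Let $\widetilde B_+$ be the set of Borel functions $\phi\ge0$ on $(0,\infty)$ such that $\phi-1$ has compact support in $(0,\infty)$ and $\|\phi-1\|_\infty<1$; for $\phi\in\widetilde B_+$ and $\eta\in\mathcal N$ put $\Pi_\phi(\eta)=\exp\int\log\phi\,d\eta$, the product of $\phi$ over the points of $\eta$ counted with multiplicity. Write $|z|=z_1+\cdots+z_k$. Then for every $k\ge1$ the following hold. (1) The $k$-th correlation function of $\xi$ exists and is $$r_k(z_1,\dots,z_k)=\frac{\theta^k}{z_1\cdots z_k}\int_{(|z|,\infty)}\rho(dv)\Big(1-\frac{|z|}{v}\Big)^{\theta-1},$$ and $r_k(z)<\infty$ for Lebesgue-a.e. $z\in(0,\infty)^k$. (2) The reduced Palm distributions are characterized by the identity $$\int_{\mathcal N}\Pi_\phi(\eta)\,P_z(d\eta)=\frac{\int_{(|z|,\infty)}\rho(dv)\big(1-\frac{|z|}{v}\big)^{\theta-1}E\big[\prod_{i:X_i>0}\phi((v-|z|)X_i)\big]}{\int_{(|z|,\infty)}\rho(dv)\big(1-\frac{|z|}{v}\big)^{\theta-1}}\quad\text{for all }\phi\in\widetilde B_+,\qquad(*)$$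 in the following sense (both sides of $(*)$ take values in $[0,\infty]$): (a) there is a family $(P_z)$ of $k$-th order reduced Palm distributions of $\xi$ which satisfies $(*)$ at every $z\in(0,\infty)^k$ with $P(V>|z|)>0$ and $r_k(z)<\infty$; (b) for each such $z$, at most one probability measure on $\mathcal N$ satisfies $(*)$; (c) a measurable family $(P_z)$ of probability measures on $\mathcal N$ is a family of $k$-th order reduced Palm distributions of $\xi$ if and only if $(*)$ holds for $q_k$-a.e. $z$. Finally, if $V$ has the gamma density $\Gamma(\theta)^{-1}b^\theta v^{\theta-1}e^{-bv}$ on $(0,\infty)$ for some $b>0$, then $\xi$ is a Poisson point process on $(0,\infty)$ with mean measure $\theta y^{-1}e^{-by}\,dy$. -/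

import Mathlib

open MeasureTheory ProbabilityTheory Set
open scoped ENNReal NNReal

noncomputable section

/-! ### Ranked sequences -/

/-- The simplex `Ω₁` of sequences `x₁ ≥ x₂ ≥ … ≥ 0` with `∑ xᵢ = 1`. -/
def RankedSimplex : Set (ℕ → ℝ) :=
  {x | Antitone x ∧ (∀ i, 0 ≤ x i) ∧ HasSum x 1}

/-- The cone `Ω` of sequences `z₁ ≥ z₂ ≥ … ≥ 0` with `0 < ∑ zᵢ < ∞`. -/
def RankedCone : Set (ℕ → ℝ) :=
  {z | Antitone z ∧ (∀ i, 0 ≤ z i) ∧ Summable z ∧ 0 < ∑' i, z i}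

/-- The dilation `x ↦ v x = (v xᵢ)ᵢ` by `v > 0`, from `Ω₁` to `Ω`. -/
def liftSeq (v : Ioi (0 : ℝ)) (x : RankedSimplex) : RankedCone :=
  ⟨fun i => (v : ℝ) * (x : ℕ → ℝ) i, by
    obtain ⟨v, hv⟩ := v
    obtain ⟨x, hanti, hnonneg, hsum⟩ := x
    have hv' : 0 < v := hv
    have hs := hsum.mul_left v
    refine ⟨fun i j hij => mul_le_mul_of_nonneg_left (hanti hij) hv'.le,
      fun i => mul_nonneg hv'.le (hnonneg i), hs.summable, ?_⟩
    change 0 < ∑' i, v * x i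
    rw [hs.tsum_eq]
    simpa using hv'⟩

/-! ### The Poisson-Dirichlet distribution -/

/-- The stick-breaking sequence `b₀, b₁ (1 - b₀), b₂ (1 - b₁) (1 - b₀), …`. -/
def stickBreaking (b : ℕ → ℝ) (n : ℕ) : ℝ :=
  b n * ∏ j ∈ Finset.range n, (1 - b j)

/-- Decreasing rearrangement of a nonnegative sequence tending to zero: the `n`-th term
(`n = 0, 1, …`) is the largest number `t` such that at least `n + 1` of the terms are `≥ t`. -/
def decreasingRearrangement (y : ℕ → ℝ) (n : ℕ) : ℝ :=
  ⨆ S : {S : Finset ℕ // S.card = n + 1}, ⨅ i : S.1, y i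

/-- The GEM distribution: the law of the stick-breaking sequence built from independent
`Beta(1, θ)` random variables. -/
def gemMeasure (θ : ℝ) (hθ : 0 < θ) : Measure (ℕ → ℝ) :=
  have : IsProbabilityMeasure (betaMeasure 1 θ) := isProbabilityMeasureBeta one_pos hθ
  (Measure.infinitePi (fun _ : ℕ => betaMeasure 1 θ)).map stickBreaking

/-- The Poisson-Dirichlet distribution `PD(θ)`: the law of the decreasing rearrangement of a
GEM sequence with parameter `θ`. -/
def poissonDirichlet (θ : ℝ) (hθ : 0 < θ) : Measure (ℕ → ℝ) :=
  (gemMeasure θ hθ).map decreasingRearrangement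

theorem measurable_stickBreaking : Measurable stickBreaking := by
  refine measurable_pi_lambda _ fun n => ?_
  unfold stickBreaking
  fun_prop

theorem measurable_decreasingRearrangement : Measurable decreasingRearrangement :=
  measurable_pi_lambda _ fun _ =>
    Measurable.iSup fun _ => Measurable.iInf fun i => measurable_pi_apply (i : ℕ)

/-! ### Point configurations on `(0, ∞)` -/

/-- `η` is a `ℤ₊`-valued Radon measure on `(0, ∞)`, regarded as a measure on `ℝ` that does not
charge `(-∞, 0]`: its value on each Borel set that is relatively compact in `(0, ∞)` is a
natural number. -/
def IsPointConfig (η : Measure ℝ) : Prop :=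
  η (Iic 0) = 0 ∧
    ∀ a b : ℝ, 0 < a → ∀ A : Set ℝ, MeasurableSet A → A ⊆ Icc a b → ∃ n : ℕ, η A = n

/-- The space `𝒩` of locally finite point configurations on `(0, ∞)` (with multiplicities).
Its `σ`-algebra, inherited from `Measure ℝ`, is generated by the evaluations `η ↦ η A`; this is
the Borel `σ`-algebra of the vague topology. -/
abbrev PointConfig : Type := {η : Measure ℝ // IsPointConfig η}

theorem isPointConfig_sum_dirac {ι : Type*} (z : ι → ℝ)
    (hz : ∀ a : ℝ, 0 < a → {i | a ≤ z i}.Finite) :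
    IsPointConfig ((Measure.sum fun i => Measure.dirac (z i)).restrict (Ioi 0)) := by
  refine ⟨?_, fun a b ha A hA hAab => ?_⟩
  · rw [Measure.restrict_apply measurableSet_Iic]
    simp
  · have hA0 : A ∩ Ioi 0 = A := inter_eq_left.2 fun x hx => lt_of_lt_of_le ha (hAab hx).1
    have hfin : {i | z i ∈ A}.Finite := (hz a ha).subset fun i hi => (hAab hi).1
    refine ⟨hfin.toFinset.card, ?_⟩
    rw [Measure.restrict_apply hA, hA0, Measure.sum_apply _ hA,
      tsum_eq_sum (s := hfin.toFinset) (fun i hi => ?_), Finset.sum_congr rfl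
      (g := fun _ => (1 : ℝ≥0∞)) (fun i hi => ?_)]
    · simp
    · rw [Measure.dirac_apply' _ hA]
      exact indicator_of_mem (by simpa using hi) _
    · rw [Measure.dirac_apply' _ hA]
      simpa using hi

/-- The point configuration `Ξ(z) = ∑ᵢ 1_{zᵢ > 0} δ_{zᵢ}` of a sequence `z ∈ Ω`. -/
def configOfSeq (z : RankedCone) : PointConfig :=
  ⟨(Measure.sum fun i => Measure.dirac ((z : ℕ → ℝ) i)).restrict (Ioi 0), by
    refine isPointConfig_sum_dirac _ fun a ha => ?_
    have h := (z.2.2.2.1.tendsto_cofinite_zero).eventually (gt_mem_nhds ha)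
    simpa [Filter.eventually_cofinite] using h⟩

/-- The configuration `η + δ_{z₁} + ⋯ + δ_{z_k}`, where `z₁, …, z_k > 0`
(nonpositive `z_l` are ignored). -/
def addAtoms {k : ℕ} (η : PointConfig) (z : Fin k → ℝ) : PointConfig :=
  ⟨η.1 + (Measure.sum fun l => Measure.dirac (z l)).restrict (Ioi 0), by
    obtain ⟨h0, h1⟩ := η.2
    obtain ⟨g0, g1⟩ := isPointConfig_sum_dirac z fun a _ => Set.toFinite _
    refine ⟨by rw [Measure.add_apply, h0, g0, add_zero], fun a b ha A hA hAab => ?_⟩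
    obtain ⟨n, hn⟩ := h1 a b ha A hA hAab
    obtain ⟨m, hm⟩ := g1 a b ha A hA hAab
    exact ⟨n + m, by rw [Measure.add_apply, hn, hm, Nat.cast_add]⟩⟩

/-! ### Correlation measures and reduced Palm distributions -/

/-- The open orthant `(0, ∞)^k`. -/
def posOrthant (k : ℕ) : Set (Fin k → ℝ) := {z | ∀ l, 0 < z l}

/-- The modified product counting measure
`ξ^{[k]} = ∑_{i₁, …, i_k distinct} δ_{(z_{i₁}, …, z_{i_k})}` on `(0, ∞)^k` of the configuration
`ξ = ∑ 1_{zᵢ > 0} δ_{zᵢ}`. -/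
def factorialMeasure (k : ℕ) (z : ℕ → ℝ) : Measure (Fin k → ℝ) :=
  (Measure.sum fun i : Fin k ↪ ℕ => Measure.dirac fun l => z (i l)).restrict (posOrthant k)

variable {Ω : Type*} [MeasurableSpace Ω]

/-- The `k`-th correlation measure of the point process `∑ 1_{Zᵢ > 0} δ_{Zᵢ}`: the mean measure
of its modified product counting measure. -/
def correlationMeasure (P : Measure Ω) (Z : Ω → RankedCone) (k : ℕ) : Measure (Fin k → ℝ) :=
  P.bind fun ω => factorialMeasure k (Z ω)

/-- `r` is the `k`-th correlation function of `∑ 1_{Zᵢ > 0} δ_{Zᵢ}`: the density of the `k`-th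
correlation measure with respect to Lebesgue measure on `(0, ∞)^k`. -/
def IsCorrelationFunction (P : Measure Ω) (Z : Ω → RankedCone) (k : ℕ)
    (r : (Fin k → ℝ) → ℝ≥0∞) : Prop :=
  Measurable r ∧ correlationMeasure P Z k = (volume.restrict (posOrthant k)).withDensity r

/-- The (measurable) family of probability measures `Q z` on `𝒩` is the family of `k`-th order
reduced Palm distributions of `ξ = ∑ 1_{Zᵢ > 0} δ_{Zᵢ}`: the `k`-th order Palm formula holds. -/
def IsReducedPalm (P : Measure Ω) (Z : Ω → RankedCone) (k : ℕ)
    (Q : Kernel (Fin k → ℝ) PointConfig) : Prop :=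
  ∀ G : (Fin k → ℝ) × PointConfig → ℝ≥0∞, Measurable G →
    ∫⁻ ω, ∫⁻ z, G (z, configOfSeq (Z ω)) ∂(factorialMeasure k (Z ω)) ∂P =
      ∫⁻ z, ∫⁻ η, G (z, addAtoms η z) ∂(Q z) ∂(correlationMeasure P Z k)

/-! ### Multiplicative functionals -/

/-- The class `B̃₊` of Borel functions `φ ≥ 0` on `(0, ∞)` such that `φ - 1` has compact support
in `(0, ∞)` and `‖φ - 1‖_∞ < 1`. Only the values of `φ` on `(0, ∞)` play a role. -/
def IsTestFunction (φ : ℝ → ℝ) : Prop :=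
  Measurable φ ∧ (∀ x, 0 < x → 0 ≤ φ x) ∧
    (∃ a b : ℝ, 0 < a ∧ ∀ x, 0 < x → x ∉ Icc a b → φ x = 1) ∧
    (∃ c : ℝ, c < 1 ∧ ∀ x, 0 < x → |φ x - 1| ≤ c)

/-- `Π_φ(η) = exp ⟨log φ, η⟩`, the product of the values of `φ` over the points of `η`. -/
def configProd (φ : ℝ → ℝ) (η : PointConfig) : ℝ :=
  Real.exp (∫ x, Real.log (φ x) ∂η.1)

/-- `Π_φ(z) = ∏_{i : zᵢ > 0} φ(zᵢ)`. -/
def seqProd (φ : ℝ → ℝ) (z : ℕ → ℝ) : ℝ :=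
  ∏ᶠ i, if 0 < z i then φ (z i) else 1

/-! ### Poisson point processes -/

/-- `ξ` is a Poisson point process on `(0, ∞)` with mean measure `μ` (a measure on `ℝ` carried by
`(0, ∞)`): the numbers of points in disjoint Borel sets of finite mean measure are independent,
and the number of points in `A` has the Poisson distribution with mean `μ A`. -/
def IsPoissonProcess (P : Measure Ω) (ξ : Ω → PointConfig) (μ : Measure ℝ) : Prop :=
  Measurable ξ ∧
    (∀ A : Set ℝ, MeasurableSet A → μ A ≠ ∞ →
      P.map (fun ω => (ξ ω).1 A) =
        (poissonMeasure (μ A).toNNReal).map (fun n : ℕ => (n : ℝ≥0∞))) ∧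
    (∀ (n : ℕ) (A : Fin n → Set ℝ), (∀ i, MeasurableSet (A i)) → (∀ i, μ (A i) ≠ ∞) →
      Pairwise (fun i j => Disjoint (A i) (A j)) →
      iIndepFun (fun i ω => (ξ ω).1 (A i)) P)

/-! ### The formulas for lifted Poisson-Dirichlet processes -/

/-- `∫_{(|z|, ∞)} ρ(dv) (1 - |z| / v)^{θ - 1}`, where `|z| = z₁ + ⋯ + z_k`. -/
def palmMass (θ : ℝ) (ρ : Measure ℝ) {k : ℕ} (z : Fin k → ℝ) : ℝ≥0∞ :=
  ∫⁻ v in Ioi (∑ l, z l), ENNReal.ofReal ((1 - (∑ l, z l) / v) ^ (θ - 1)) ∂ρ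

/-- `θ^k / (z₁ ⋯ z_k) ∫_{(|z|, ∞)} ρ(dv) (1 - |z| / v)^{θ - 1}`. -/
def liftedCorrelation (θ : ℝ) (ρ : Measure ℝ) {k : ℕ} (z : Fin k → ℝ) : ℝ≥0∞ :=
  ENNReal.ofReal (θ ^ k / ∏ l, z l) * palmMass θ ρ z

/-- The probability measure `Q` on `𝒩` satisfies, for every `φ` in `B̃₊`,
`∫ Π_φ dQ = ∫_{(|z|, ∞)} ρ(dv) (1 - |z| / v)^{θ - 1} E[∏ᵢ φ((v - |z|) Xᵢ)] /
  ∫_{(|z|, ∞)} ρ(dv) (1 - |z| / v)^{θ - 1}`. -/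
def SatisfiesPalmIdentity (θ : ℝ) (ρ : Measure ℝ) (P : Measure Ω) (X : Ω → RankedSimplex)
    {k : ℕ} (z : Fin k → ℝ) (Q : Measure PointConfig) : Prop :=
  ∀ φ : ℝ → ℝ, IsTestFunction φ →
    ∫⁻ η, ENNReal.ofReal (configProd φ η) ∂Q =
      (∫⁻ v in Ioi (∑ l, z l), ENNReal.ofReal ((1 - (∑ l, z l) / v) ^ (θ - 1)) *
        ∫⁻ ω, ENNReal.ofReal
          (seqProd φ fun i => (v - ∑ l, z l) * (X ω : ℕ → ℝ) i) ∂P ∂ρ) / palmMass θ ρ z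

end

/-! Everything rests on one Palm formula for the Poisson–Dirichlet sequence. A GEM sequence is a
Beta(1, θ) stick `x` followed by an independent GEM sequence scaled by `1 - x`. Weighted by `1 -
Y₀`, the joint density of the first two sticks is symmetric, and this symmetry makes the first term
a size-biased pick (`lintegral_sizeBiased`): choosing a term with probability equal to its size
gives `Y₀` and leaves the sequence of the other terms. Dividing by the size and iterating over `k`
picks (`lintegral_palmSum`) shows that a sum over `k`-tuples of distinct terms has density `θ^k /
(z₁ ⋯ z_k) (1 - |z|)^(θ - 1)`, and that the remaining terms form an independent GEM sequence of
total mass `1 - |z|`.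

The ranked sequence is almost surely a permutation of the GEM sequence, and configurations ignore
order, so the formula passes to `X`. Dilating by `v` and integrating over `ρ` gives
`lintegral_factorialMeasure_liftSeq`. Functions of `z` alone yield the correlation function; general
ones identify the reduced Palm law as a mixture over `v` of the configurations of `(v - |z|) X`,
whose multiplicative functionals are the right-hand side of the identity. Finiteness of `r_k` comes
from a moment bound for small `v` and a direct bound for large `v`.

Uniqueness holds because the functionals `exp (-∑ nⱼ η(Iⱼ))`, with rational intervals `Iⱼ` and
natural numbers `nⱼ`, are the joint moments of the `[0, 1]`-valued variables `exp (-η(Iⱼ))`, and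
these moments determine a law on `𝒩` (`PointConfig.measure_ext`). Countably many functionals
suffice, so the argument also works almost everywhere in `z`.

In the gamma case the weight `(1 - x / v)^(θ - 1)` turns the density at `v = u + x` into `θ x⁻¹ exp
(-b x)` times the density at `u`. The Palm formula for `k = 1` becomes Mecke's formula, which forces
`ξ` to be Poisson (`MeckeFormula.isPoisson`). -/

section

/-! ### Prepending to and deleting from a sequence -/

/-- The sequence `x, y₀, y₁, …`. -/
def seqCons (x : ℝ) (y : ℕ → ℝ) : ℕ → ℝ
  | 0 => x
  | n + 1 => y n

/-- The sequence `y` with its `i`-th term deleted. -/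
def seqErase (i : ℕ) (y : ℕ → ℝ) : ℕ → ℝ :=
  fun j => y (if j < i then j else j + 1)

@[simp] theorem seqCons_zero (x : ℝ) (y : ℕ → ℝ) : seqCons x y 0 = x := rfl

@[simp] theorem seqCons_succ (x : ℝ) (y : ℕ → ℝ) (n : ℕ) : seqCons x y (n + 1) = y n := rfl

@[simp] theorem seqErase_zero_seqCons (x : ℝ) (y : ℕ → ℝ) : seqErase 0 (seqCons x y) = y := by
  funext j; simp [seqErase]

theorem seqErase_succ_seqCons (i : ℕ) (x : ℝ) (y : ℕ → ℝ) :
    seqErase (i + 1) (seqCons x y) = seqCons x (seqErase i y) := by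
  funext j
  cases j with
  | zero => simp [seqErase]
  | succ j => by_cases h : j < i <;> simp [seqErase, h]

theorem seqErase_smul (i : ℕ) (c : ℝ) (y : ℕ → ℝ) : seqErase i (c • y) = c • seqErase i y := rfl

@[fun_prop]
theorem measurable_seqCons {α : Type*} [MeasurableSpace α] {f : α → ℝ} {g : α → ℕ → ℝ}
    (hf : Measurable f) (hg : Measurable g) : Measurable fun a => seqCons (f a) (g a) := by
  refine measurable_pi_lambda _ fun n => ?_
  cases n with
  | zero => exact hf
  | succ n => exact (measurable_pi_apply n).comp hg

@[fun_prop]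
theorem measurable_seqErase {α : Type*} [MeasurableSpace α] (i : ℕ) {g : α → ℕ → ℝ}
    (hg : Measurable g) : Measurable fun a => seqErase i (g a) :=
  measurable_pi_lambda _ fun _ => (measurable_pi_apply _).comp hg

theorem map_seqCons_prod_infinitePi (β : Measure ℝ) [IsProbabilityMeasure β] :
    (β.prod (Measure.infinitePi fun _ : ℕ => β)).map (fun p => seqCons p.1 p.2) =
      Measure.infinitePi fun _ : ℕ => β := by
  classical
  refine Measure.eq_infinitePi _ fun s t ht => ?_
  -- The cylinder is enlarged to an initial segment, with the whole line in the new coordinates, so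
  -- that removing coordinate `0` again leaves an initial segment.
  obtain ⟨N, hN⟩ : ∃ N, s ⊆ Finset.range (N + 1) := by
    obtain ⟨N, hN⟩ := s.exists_nat_subset_range
    exact ⟨N, hN.trans (Finset.range_mono N.le_succ)⟩
  set u : ℕ → Set ℝ := fun i => if i ∈ s then t i else univ with hu
  have hum : ∀ i, MeasurableSet (u i) := fun i => by
    by_cases h : i ∈ s <;> simp [hu, h, ht]
  have hpi : (s : Set ℕ).pi t = (Finset.range (N + 1) : Set ℕ).pi u := by
    ext y
    simp only [Set.mem_pi, Finset.mem_coe, hu]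
    refine ⟨fun h i _ => ?_, fun h i hi => ?_⟩
    · by_cases his : i ∈ s <;> simp [his, h]
    · simpa [hi] using h i (hN hi)
  have hprod : ∏ i ∈ s, β (t i) = ∏ i ∈ Finset.range (N + 1), β (u i) := by
    rw [← Finset.prod_subset hN (f := fun i => β (u i))]
    · exact Finset.prod_congr rfl fun i hi => by simp [hu, hi]
    · intro i _ hi
      simp [hu, hi]
  rw [hprod, hpi, Measure.map_apply (by fun_prop) (MeasurableSet.pi (Finset.countable_toSet _)
    fun i _ => hum i)]
  have hpre : (fun p : ℝ × (ℕ → ℝ) => seqCons p.1 p.2) ⁻¹' (Finset.range (N + 1) : Set ℕ).pi u =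
      u 0 ×ˢ (Finset.range N : Set ℕ).pi fun i => u (i + 1) := by
    ext ⟨x, y⟩
    simp only [mem_preimage, Set.mem_pi, Finset.mem_coe, Finset.mem_range, mem_prod]
    refine ⟨fun h => ⟨h 0 (by omega), fun i hi => h (i + 1) (by omega)⟩, fun h i hi => ?_⟩
    cases i with
    | zero => exact h.1
    | succ i => exact h.2 i (by omega)
  rw [hpre, Measure.prod_prod, Measure.infinitePi_pi _ fun i _ => hum (i + 1),
    Finset.prod_range_succ', mul_comm]

/-! ### The stick-breaking recursion -/

theorem stickBreaking_seqCons (x : ℝ) (b : ℕ → ℝ) :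
    stickBreaking (seqCons x b) = seqCons x ((1 - x) • stickBreaking b) := by
  funext n
  cases n with
  | zero => simp [stickBreaking]
  | succ n => simp [stickBreaking, Finset.prod_range_succ']; ring

variable {θ : ℝ}

theorem isProbabilityMeasure_gemMeasure (hθ : 0 < θ) : IsProbabilityMeasure (gemMeasure θ hθ) := by
  have : IsProbabilityMeasure (betaMeasure 1 θ) := isProbabilityMeasureBeta one_pos hθ
  exact Measure.isProbabilityMeasure_map measurable_stickBreaking.aemeasurable

theorem lintegral_betaMeasure_one (hθ : 0 < θ) {F : ℝ → ℝ≥0∞} (hF : Measurable F) :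
    ∫⁻ x, F x ∂betaMeasure 1 θ =
      ∫⁻ x, (Ioo (0 : ℝ) 1).indicator (fun x => ENNReal.ofReal (θ * (1 - x) ^ (θ - 1))) x * F x := by
  have hm : Measurable (betaPDF 1 θ) := (measurable_betaPDFReal 1 θ).ennreal_ofReal
  rw [betaMeasure, lintegral_withDensity_eq_lintegral_mul _ hm hF]
  refine lintegral_congr fun x => ?_
  rw [Pi.mul_apply, betaPDF_eq]
  congr 1
  by_cases hx : x ∈ Ioo (0 : ℝ) 1
  · have h1 : (1 : ℝ) / beta 1 θ = θ := by
      rw [beta, Real.Gamma_one, add_comm, Real.Gamma_add_one hθ.ne']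
      have := (Real.Gamma_pos_of_pos hθ).ne'
      field_simp
    rw [indicator_of_mem hx, if_pos (show 0 < x ∧ x < 1 from hx), h1]
    simp
  · rw [indicator_of_notMem hx, if_neg (show ¬ (0 < x ∧ x < 1) from hx), ENNReal.ofReal_zero]

theorem ae_mem_Ioo_betaMeasure (θ : ℝ) : ∀ᵐ x ∂betaMeasure 1 θ, x ∈ Ioo (0 : ℝ) 1 := by
  have hm : Measurable (betaPDF 1 θ) := (measurable_betaPDFReal 1 θ).ennreal_ofReal
  rw [betaMeasure, ae_withDensity_iff hm]
  refine ae_of_all _ fun x hx => ?_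
  by_contra h
  exact hx (by rw [betaPDF_eq, if_neg (show ¬ (0 < x ∧ x < 1) from h), ENNReal.ofReal_zero])

/-- Self-similarity of stick-breaking: what follows the first stick `x` is an independent copy of
the whole sequence scaled by `1 - x`. The later inductions condition on the first stick through this
formula. -/
theorem lintegral_gemMeasure (hθ : 0 < θ) {F : (ℕ → ℝ) → ℝ≥0∞} (hF : Measurable F) :
    ∫⁻ y, F y ∂gemMeasure θ hθ =
      ∫⁻ x, ∫⁻ y, F (seqCons x ((1 - x) • y)) ∂gemMeasure θ hθ ∂betaMeasure 1 θ := by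
  have : IsProbabilityMeasure (betaMeasure 1 θ) := isProbabilityMeasureBeta one_pos hθ
  have hs := measurable_stickBreaking
  have hsF : Measurable fun b => F (stickBreaking b) := hF.comp hs
  have hF2 : ∀ x : ℝ, Measurable fun y : ℕ → ℝ => F (seqCons x ((1 - x) • y)) := fun x => by
    fun_prop
  simp only [gemMeasure]
  rw [lintegral_map hF hs, ← map_seqCons_prod_infinitePi, lintegral_map hsF (by fun_prop),
    lintegral_prod _ (by fun_prop), map_seqCons_prod_infinitePi]
  refine lintegral_congr fun x => ?_
  rw [lintegral_map (hF2 x) hs]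
  simp only [stickBreaking_seqCons]

/-- The first `n` sticks add up to `1 - ∏ (1 - bⱼ) < 1`. Summability is all that is recorded; that
the total is one is not needed here. -/
theorem ae_gemMeasure (hθ : 0 < θ) :
    ∀ᵐ y ∂gemMeasure θ hθ, (∀ i, 0 < y i) ∧ Summable y := by
  have : IsProbabilityMeasure (betaMeasure 1 θ) := isProbabilityMeasureBeta one_pos hθ
  have hb : ∀ᵐ b ∂(Measure.infinitePi fun _ : ℕ => betaMeasure 1 θ), ∀ i, b i ∈ Ioo (0 : ℝ) 1 := by
    rw [ae_all_iff]
    intro i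
    exact (measurePreserving_eval_infinitePi (fun _ : ℕ => betaMeasure 1 θ) i).quasiMeasurePreserving.ae
      (ae_mem_Ioo_betaMeasure θ)
  have hsum : ∀ (b : ℕ → ℝ) (n : ℕ),
      ∑ i ∈ Finset.range n, stickBreaking b i = 1 - ∏ j ∈ Finset.range n, (1 - b j) := by
    intro b n
    induction n with
    | zero => simp
    | succ n ih => rw [Finset.sum_range_succ, ih, Finset.prod_range_succ, stickBreaking]; ring
  have hpos : ∀ b : ℕ → ℝ, (∀ i, b i ∈ Ioo (0 : ℝ) 1) →
      (∀ i, 0 < stickBreaking b i) ∧ Summable (stickBreaking b) := by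
    intro b hb
    have hprod : ∀ n, 0 < ∏ j ∈ Finset.range n, (1 - b j) := fun n =>
      Finset.prod_pos fun j _ => sub_pos.2 (hb j).2
    have h1 : ∀ i, 0 < stickBreaking b i := fun i => mul_pos (hb i).1 (hprod i)
    refine ⟨h1, summable_of_sum_range_le (c := 1) (fun i => (h1 i).le) fun n => ?_⟩
    rw [hsum]
    linarith [hprod n]
  have hms : MeasurableSet {y : ℕ → ℝ | (∀ i, 0 < y i) ∧ Summable y} := by
    -- For positive sequences summability is finiteness of a sum in `ℝ≥0∞`, which is visibly
    -- measurable.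
    have : {y : ℕ → ℝ | (∀ i, 0 < y i) ∧ Summable y} =
        {y : ℕ → ℝ | ∀ i, 0 < y i} ∩ {y | ∑' i, ENNReal.ofReal (y i) ≠ ∞} := by
      ext y
      simp only [mem_inter_iff, mem_ofPred_eq, and_congr_right_iff]
      intro hy
      refine ⟨fun h => h.tsum_ofReal_ne_top, fun h => ?_⟩
      have := ENNReal.summable_toReal h
      simpa [ENNReal.toReal_ofReal (hy _).le] using this
    rw [this]
    have h1 : MeasurableSet {y : ℕ → ℝ | ∀ i, 0 < y i} := by
      rw [ofPred_forall]
      exact MeasurableSet.iInter fun i => measurableSet_lt measurable_const (measurable_pi_apply i)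
    have hmt : Measurable fun y : ℕ → ℝ => ∑' i, ENNReal.ofReal (y i) :=
      Measurable.tsum fun i => (measurable_pi_apply i).ennreal_ofReal
    exact h1.inter (hmt (measurableSet_singleton _).compl)
  simp only [gemMeasure]
  rw [ae_map_iff measurable_stickBreaking.aemeasurable hms]
  filter_upwards [hb] with b hb using hpos b hb

end

section

/-! ### Size-biased picks from a GEM sequence -/

theorem lintegral_comp_smul_of_pos {E : Type*} [NormedAddCommGroup E] [NormedSpace ℝ E]
    [MeasurableSpace E] [BorelSpace E] [FiniteDimensional ℝ E] (μ : Measure E)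
    [μ.IsAddHaarMeasure] {f : E → ℝ≥0∞} (hf : Measurable f) {c : ℝ} (hc : 0 < c) :
    ENNReal.ofReal (c ^ Module.finrank ℝ E) * ∫⁻ x, f (c • x) ∂μ = ∫⁻ x, f x ∂μ := by
  have h := Measure.map_addHaar_smul μ hc.ne'
  have h1 : ∫⁻ x, f (c • x) ∂μ = ENNReal.ofReal |(c ^ Module.finrank ℝ E)⁻¹| * ∫⁻ x, f x ∂μ := by
    rw [← lintegral_map hf (measurable_const_smul c), h, lintegral_smul_measure, smul_eq_mul]
  have hcp : 0 < c ^ Module.finrank ℝ E := by positivity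
  rw [h1, ← mul_assoc, ← ENNReal.ofReal_mul hcp.le, abs_of_pos (inv_pos.2 hcp),
    mul_inv_cancel₀ hcp.ne', ENNReal.ofReal_one, one_mul]

/-- The density of the first two terms `(Y₀, Y₁)` of a GEM sequence, multiplied by `1 - Y₀`. -/
noncomputable def twoStickDensity (θ x y : ℝ) : ℝ≥0∞ :=
  {p : ℝ × ℝ | 0 < p.1 ∧ 0 < p.2 ∧ p.1 + p.2 < 1}.indicator
    (fun p => ENNReal.ofReal (θ ^ 2 * (1 - (p.1 + p.2)) ^ (θ - 1))) (x, y)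

theorem twoStickDensity_comm (θ x y : ℝ) : twoStickDensity θ x y = twoStickDensity θ y x := by
  unfold twoStickDensity indicator
  have : (0 < x ∧ 0 < y ∧ x + y < 1) ↔ (0 < y ∧ 0 < x ∧ y + x < 1) := by
    rw [add_comm x y]; tauto
  simp only [mem_ofPred_eq, this]
  simp only [add_comm x y]

theorem measurable_twoStickDensity (θ : ℝ) :
    Measurable fun p : ℝ × ℝ => twoStickDensity θ p.1 p.2 := by
  refine Measurable.indicator (by fun_prop) ?_
  exact (measurableSet_lt measurable_const measurable_fst).inter
    ((measurableSet_lt measurable_const measurable_snd).inter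
      (measurableSet_lt (measurable_fst.add measurable_snd) measurable_const))

variable {θ : ℝ}

/-- The second term is `(1 - x) u` with `u` Beta distributed, and `1 - (x + (1 - x) u) = (1 - x) (1
- u)`. The Jacobian `1 - x` of this substitution is the factor built into `twoStickDensity`. -/
theorem twoStickDensity_mul (hθ : 0 < θ) {x : ℝ} (hx : x ∈ Ioo (0 : ℝ) 1) (u : ℝ) :
    twoStickDensity θ x ((1 - x) * u) =
      ENNReal.ofReal (θ * (1 - x) ^ (θ - 1)) *
        (Ioo (0 : ℝ) 1).indicator (fun x => ENNReal.ofReal (θ * (1 - x) ^ (θ - 1))) u := by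
  have h1 : 0 < 1 - x := sub_pos.2 hx.2
  have hiff : (0 < x ∧ 0 < (1 - x) * u ∧ x + (1 - x) * u < 1) ↔ u ∈ Ioo (0 : ℝ) 1 := by
    rw [mul_pos_iff_of_pos_left h1, mem_Ioo]
    refine ⟨fun h => ⟨h.2.1, by nlinarith [h.2.2]⟩, fun h => ⟨hx.1, h.1, by nlinarith [h.2]⟩⟩
  unfold twoStickDensity
  by_cases hu : u ∈ Ioo (0 : ℝ) 1
  · have h2 : 0 < 1 - u := sub_pos.2 hu.2
    rw [indicator_of_mem hu, indicator_of_mem (by exact hiff.2 hu), ← ENNReal.ofReal_mul (by positivity)]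
    congr 1
    rw [show 1 - (x + (1 - x) * u) = (1 - x) * (1 - u) by ring, Real.mul_rpow h1.le h2.le]
    ring
  · rw [indicator_of_notMem hu, indicator_of_notMem (by exact fun h => hu (hiff.1 h)), mul_zero]

theorem lintegral_gemMeasure_two (hθ : 0 < θ) {H : ℝ → ℝ → (ℕ → ℝ) → ℝ≥0∞}
    (hH : Measurable fun p : ℝ × ℝ × (ℕ → ℝ) => H p.1 p.2.1 p.2.2) :
    ∫⁻ y, ENNReal.ofReal (1 - y 0) * H (y 0) (y 1) (fun n => y (n + 2)) ∂gemMeasure θ hθ =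
      ∫⁻ x, ∫⁻ y, twoStickDensity θ x y *
        ∫⁻ s, H x y ((1 - (x + y)) • s) ∂gemMeasure θ hθ := by
  have := isProbabilityMeasure_gemMeasure hθ
  have : IsProbabilityMeasure (betaMeasure 1 θ) := isProbabilityMeasureBeta one_pos hθ
  have hH' : ∀ {α : Type} [MeasurableSpace α] {f g : α → ℝ} {h : α → ℕ → ℝ}, Measurable f →
      Measurable g → Measurable h → Measurable fun a => H (f a) (g a) (h a) :=
    fun hf hg hh => hH.comp (hf.prodMk (hg.prodMk hh))
  have hK : Measurable fun p : ℝ × ℝ =>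
      ∫⁻ s, H p.1 p.2 ((1 - (p.1 + p.2)) • s) ∂gemMeasure θ hθ :=
    Measurable.lintegral_prod_right (hH' (by fun_prop) (by fun_prop) (by fun_prop))
  have hE := measurable_twoStickDensity θ
  have e1 : ∫⁻ y, ENNReal.ofReal (1 - y 0) * H (y 0) (y 1) (fun n => y (n + 2)) ∂gemMeasure θ hθ =
      ∫⁻ x, ENNReal.ofReal (1 - x) * ∫⁻ u, ∫⁻ s, H x ((1 - x) * u) ((1 - (x + (1 - x) * u)) • s)
        ∂gemMeasure θ hθ ∂betaMeasure 1 θ ∂betaMeasure 1 θ := by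
    rw [lintegral_gemMeasure hθ]
    swap
    · fun_prop
    refine lintegral_congr fun x => ?_
    simp only [seqCons_zero]
    rw [lintegral_const_mul _ (hH' (by fun_prop) (by fun_prop) (by fun_prop)),
      lintegral_gemMeasure hθ (hH' (by fun_prop) (by fun_prop) (by fun_prop))]
    congr 1
    refine lintegral_congr fun u => lintegral_congr fun s => ?_
    congr 1
    funext n
    simp only [seqCons_succ, Pi.smul_apply, smul_eq_mul]
    ring
  rw [e1, lintegral_betaMeasure_one hθ]
  · refine lintegral_congr fun x => ?_
    by_cases hx : x ∈ Ioo (0 : ℝ) 1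
    · have h1 : 0 < 1 - x := sub_pos.2 hx.2
      have hf : Measurable fun y => twoStickDensity θ x y *
          ∫⁻ s, H x y ((1 - (x + y)) • s) ∂gemMeasure θ hθ :=
        (hE.comp (measurable_const.prodMk measurable_id)).mul
          (hK.comp (measurable_const.prodMk measurable_id))
      rw [← lintegral_comp_smul_of_pos volume hf h1, indicator_of_mem hx,
        lintegral_betaMeasure_one hθ]
      · rw [Module.finrank_self, pow_one, mul_left_comm, ← lintegral_const_mul]
        · congr 1
          refine lintegral_congr fun u => ?_
          rw [smul_eq_mul, twoStickDensity_mul hθ hx, mul_assoc]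
        · refine Measurable.mul (Measurable.indicator (by fun_prop) measurableSet_Ioo) ?_
          exact hK.comp (by fun_prop : Measurable fun u : ℝ => (x, (1 - x) * u))
      · exact hK.comp (by fun_prop : Measurable fun u : ℝ => (x, (1 - x) * u))
    · rw [indicator_of_notMem hx, zero_mul, eq_comm, lintegral_eq_zero_iff']
      · refine ae_of_all _ fun y => ?_
        have : twoStickDensity θ x y = 0 := indicator_of_notMem (fun h => hx ⟨h.1, by
          have := h.2.1; have := h.2.2; simp only at *; linarith⟩) _
        simp [this]
      · exact ((hE.comp (measurable_const.prodMk measurable_id)).mul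
          (hK.comp (measurable_const.prodMk measurable_id))).aemeasurable
  · refine Measurable.mul (by fun_prop) (Measurable.lintegral_prod_right ?_)
    exact hK.comp (by fun_prop : Measurable fun p : ℝ × ℝ => (p.1, (1 - p.1) * p.2))

/-- Under the weight `1 - Y₀` the first two terms are exchangeable: their weighted density is
symmetric, and the tail depends on them only through their sum. -/
theorem lintegral_gemMeasure_swap (hθ : 0 < θ) {h : ℝ → (ℕ → ℝ) → ℝ≥0∞}
    (hh : Measurable (Function.uncurry h)) :
    ∫⁻ y, ENNReal.ofReal (1 - y 0) * h (y 1) (seqErase 1 y) ∂gemMeasure θ hθ =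
      ∫⁻ y, ENNReal.ofReal (1 - y 0) * h (y 0) (seqErase 0 y) ∂gemMeasure θ hθ := by
  have := isProbabilityMeasure_gemMeasure hθ
  have hh' : ∀ {α : Type} [MeasurableSpace α] {f : α → ℝ} {g : α → ℕ → ℝ}, Measurable f →
      Measurable g → Measurable fun a => h (f a) (g a) :=
    fun hf hg => hh.comp (hf.prodMk hg)
  have e1 := lintegral_gemMeasure_two hθ (H := fun x y s => h y (seqCons x s))
    (hh' (by fun_prop) (by fun_prop))
  have e2 := lintegral_gemMeasure_two hθ (H := fun x y s => h x (seqCons y s))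
    (hh' (by fun_prop) (by fun_prop))
  have s1 : ∀ y : ℕ → ℝ, seqErase 1 y = seqCons (y 0) fun n => y (n + 2) := fun y => by
    funext n; cases n <;> simp [seqErase]
  have s0 : ∀ y : ℕ → ℝ, seqErase 0 y = seqCons (y 1) fun n => y (n + 2) := fun y => by
    funext n; cases n <;> simp [seqErase]
  simp only [s0, s1]
  rw [e1, e2, lintegral_lintegral_swap]
  · refine lintegral_congr fun x => lintegral_congr fun y => ?_
    rw [twoStickDensity_comm, add_comm]
  · refine ((measurable_twoStickDensity θ).mul (Measurable.lintegral_prod_right ?_)).aemeasurable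
    exact hh' (by fun_prop) (by fun_prop)

/-- The mass of the sequence that remains after its first `n` terms. -/
noncomputable def seqRemainder (n : ℕ) (y : ℕ → ℝ) : ℝ≥0∞ :=
  ENNReal.ofReal (1 - ∑ i ∈ Finset.range n, y i)

@[fun_prop]
theorem measurable_seqRemainder (n : ℕ) : Measurable (seqRemainder n) := by
  unfold seqRemainder; fun_prop

theorem seqRemainder_succ_seqCons (n : ℕ) {x : ℝ} (hx : x ∈ Ioo (0 : ℝ) 1) (y : ℕ → ℝ) :
    seqRemainder (n + 1) (seqCons x ((1 - x) • y)) =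
      ENNReal.ofReal (1 - x) * seqRemainder n y := by
  rw [seqRemainder, seqRemainder, ← ENNReal.ofReal_mul (sub_pos.2 hx.2).le]
  congr 1
  rw [Finset.sum_range_succ']
  simp only [seqCons_succ, seqCons_zero, Pi.smul_apply, smul_eq_mul, ← Finset.mul_sum]
  ring

/-- A version of the size-biased identity in which the mass left after `n` terms is assigned to the
`n`-th one. In the induction the first stick `x` is split off; the other terms satisfy the identity
for the rescaled function `g x`, which is why `h` is quantified inside. -/
theorem sizeBiased_partial (hθ : 0 < θ) (n : ℕ) : ∀ {h : ℝ → (ℕ → ℝ) → ℝ≥0∞},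
    Measurable (Function.uncurry h) →
    ∑ i ∈ Finset.range n, ∫⁻ y, ENNReal.ofReal (y i) * h (y i) (seqErase i y) ∂gemMeasure θ hθ +
      ∫⁻ y, seqRemainder n y * h (y n) (seqErase n y) ∂gemMeasure θ hθ =
    ∫⁻ y, h (y 0) (seqErase 0 y) ∂gemMeasure θ hθ := by
  have := isProbabilityMeasure_gemMeasure hθ
  have : IsProbabilityMeasure (betaMeasure 1 θ) := isProbabilityMeasureBeta one_pos hθ
  induction n with
  | zero => intro h _; simp [seqRemainder]
  | succ n ih =>
    intro h hh
    have hh' : ∀ {α : Type} [MeasurableSpace α] {f : α → ℝ} {g : α → ℕ → ℝ}, Measurable f →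
        Measurable g → Measurable fun a => h (f a) (g a) :=
      fun hf hg => hh.comp (hf.prodMk hg)
    have hr := measurable_seqRemainder n
    -- the function seen after the removal of the first stick `x`
    let g : ℝ → ℝ → (ℕ → ℝ) → ℝ≥0∞ := fun x z s => h ((1 - x) * z) (seqCons x ((1 - x) • s))
    have hgm : ∀ x, Measurable (Function.uncurry (g x)) := fun x =>
      hh' (by fun_prop) (by fun_prop)
    have hterm : ∀ i, ∫⁻ y, ENNReal.ofReal (y (i + 1)) * h (y (i + 1)) (seqErase (i + 1) y)
        ∂gemMeasure θ hθ = ∫⁻ x, ENNReal.ofReal (1 - x) *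
          ∫⁻ y, ENNReal.ofReal (y i) * g x (y i) (seqErase i y) ∂gemMeasure θ hθ
            ∂betaMeasure 1 θ := by
      intro i
      rw [lintegral_gemMeasure hθ]
      swap
      · fun_prop
      refine lintegral_congr_ae ?_
      filter_upwards [ae_mem_Ioo_betaMeasure θ] with x hx
      rw [← lintegral_const_mul]
      swap
      · fun_prop
      refine lintegral_congr fun y => ?_
      rw [seqErase_succ_seqCons, seqErase_smul]
      simp only [seqCons_succ, Pi.smul_apply, smul_eq_mul, g]
      rw [ENNReal.ofReal_mul (sub_pos.2 hx.2).le, mul_assoc]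
    have hrem : ∫⁻ y, seqRemainder (n + 1) y * h (y (n + 1)) (seqErase (n + 1) y)
        ∂gemMeasure θ hθ = ∫⁻ x, ENNReal.ofReal (1 - x) *
          ∫⁻ y, seqRemainder n y * g x (y n) (seqErase n y) ∂gemMeasure θ hθ
            ∂betaMeasure 1 θ := by
      rw [lintegral_gemMeasure hθ]
      swap
      · fun_prop
      refine lintegral_congr_ae ?_
      filter_upwards [ae_mem_Ioo_betaMeasure θ] with x hx
      rw [← lintegral_const_mul]
      swap
      · fun_prop
      refine lintegral_congr fun y => ?_
      rw [seqErase_succ_seqCons, seqErase_smul, seqRemainder_succ_seqCons n hx]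
      simp only [seqCons_succ, Pi.smul_apply, smul_eq_mul, g]
      rw [mul_assoc]
    have hfirst : ∫⁻ y, ENNReal.ofReal (1 - y 0) * h (y 1) (seqErase 1 y) ∂gemMeasure θ hθ =
        ∫⁻ x, ENNReal.ofReal (1 - x) * ∫⁻ y, g x (y 0) (seqErase 0 y) ∂gemMeasure θ hθ
          ∂betaMeasure 1 θ := by
      rw [lintegral_gemMeasure hθ]
      swap
      · fun_prop
      refine lintegral_congr fun x => ?_
      rw [← lintegral_const_mul _ (hh' (by fun_prop) (by fun_prop))]
      refine lintegral_congr fun y => ?_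
      rw [← zero_add 1, seqErase_succ_seqCons, seqErase_smul]
      simp only [seqCons_succ, zero_add, seqCons_zero, Pi.smul_apply, smul_eq_mul]
    rw [Finset.sum_range_succ', add_right_comm]
    simp only [hterm]
    rw [hrem, ← lintegral_finsetSum, ← lintegral_add_left]
    rotate_left
    · fun_prop
    · fun_prop
    simp only [← Finset.mul_sum, ← mul_add]
    have hih : ∀ x, _ := fun x => ih (hgm x)
    simp only [hih]
    -- The induction hypothesis has produced the pick of term `1` with weight `1 - y 0`.
    -- Exchangeability turns it into the pick of term `0`, and the weights `1 - y 0` and `y 0` add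
    -- up to one.
    rw [← hfirst, lintegral_gemMeasure_swap hθ hh, ← lintegral_add_left, lintegral_gemMeasure hθ,
      lintegral_gemMeasure hθ]
    rotate_left
    · fun_prop
    · fun_prop
    · fun_prop
    refine lintegral_congr_ae ?_
    filter_upwards [ae_mem_Ioo_betaMeasure θ] with x hx
    refine lintegral_congr fun y => ?_
    rw [← add_mul, seqCons_zero, ← ENNReal.ofReal_add (sub_pos.2 hx.2).le hx.1.le]
    simp

/-- The mean remaining mass is multiplied at each stick by `c`, the mean of `1 - x` under Beta(1,
θ), and `c < 1`. -/
theorem tendsto_lintegral_seqRemainder (hθ : 0 < θ) :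
    Filter.Tendsto (fun n => ∫⁻ y, seqRemainder n y ∂gemMeasure θ hθ) Filter.atTop (nhds 0) := by
  have := isProbabilityMeasure_gemMeasure hθ
  have : IsProbabilityMeasure (betaMeasure 1 θ) := isProbabilityMeasureBeta one_pos hθ
  set c := ∫⁻ x, ENNReal.ofReal (1 - x) ∂betaMeasure 1 θ with hc
  have hc1 : c < 1 := by
    have h := lintegral_strict_mono (μ := betaMeasure 1 θ) (f := fun x => ENNReal.ofReal (1 - x))
      (g := fun _ => 1) (NeZero.ne _) (by fun_prop) ?_ ?_
    · simpa using h
    · have hle : c ≤ ∫⁻ _, 1 ∂betaMeasure 1 θ := by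
        refine lintegral_mono_ae ?_
        filter_upwards [ae_mem_Ioo_betaMeasure θ] with x hx
        exact ENNReal.ofReal_le_one.2 (by linarith [hx.1])
      exact ne_top_of_le_ne_top (by simp) hle
    · filter_upwards [ae_mem_Ioo_betaMeasure θ] with x hx
      rw [← ENNReal.ofReal_one]
      exact (ENNReal.ofReal_lt_ofReal_iff one_pos).2 (by linarith [hx.1])
  have hpow : ∀ n, ∫⁻ y, seqRemainder n y ∂gemMeasure θ hθ = c ^ n := by
    intro n
    induction n with
    | zero => simp [seqRemainder]
    | succ n ih =>
      rw [lintegral_gemMeasure hθ (measurable_seqRemainder _), pow_succ', hc,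
        ← lintegral_mul_const _ (by fun_prop)]
      refine lintegral_congr_ae ?_
      filter_upwards [ae_mem_Ioo_betaMeasure θ] with x hx
      rw [← ih, ← lintegral_const_mul _ (measurable_seqRemainder n)]
      exact lintegral_congr fun y => seqRemainder_succ_seqCons n hx y
  simp only [hpow]
  exact ENNReal.tendsto_pow_atTop_nhds_zero_of_lt_one hc1

/-- The first term of a GEM sequence is a size-biased pick from the sequence. -/
theorem lintegral_sizeBiased (hθ : 0 < θ) {h : ℝ → (ℕ → ℝ) → ℝ≥0∞}
    (hh : Measurable (Function.uncurry h)) :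
    ∫⁻ y, ∑' i, ENNReal.ofReal (y i) * h (y i) (seqErase i y) ∂gemMeasure θ hθ =
      ∫⁻ y, h (y 0) (seqErase 0 y) ∂gemMeasure θ hθ := by
  have hm : ∀ {h : ℝ → (ℕ → ℝ) → ℝ≥0∞}, Measurable (Function.uncurry h) → ∀ i,
      Measurable fun y : ℕ → ℝ => h (y i) (seqErase i y) := fun hh i =>
    hh.comp (by fun_prop : Measurable fun y : ℕ → ℝ => (y i, seqErase i y))
  rw [lintegral_tsum]
  swap
  · fun_prop
  refine le_antisymm ?_ ?_
  · rw [ENNReal.tsum_eq_iSup_nat]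
    refine iSup_le fun n => ?_
    rw [← sizeBiased_partial hθ n hh]
    exact le_self_add
  · have hmin : ∀ m : ℕ, Measurable (Function.uncurry fun x s => min (h x s) m) := fun m =>
      hh.min measurable_const
    have hsup : ∀ y : ℕ → ℝ, h (y 0) (seqErase 0 y) =
        ⨆ m : ℕ, min (h (y 0) (seqErase 0 y)) m := fun y => by
      rw [← inf_iSup_eq, ENNReal.iSup_natCast, inf_top_eq]
    rw [lintegral_congr hsup, lintegral_iSup (fun m => hm (hmin m) 0) fun a b hab y =>
      min_le_min_left _ (by exact_mod_cast hab)]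
    refine iSup_le fun m => ?_
    have hlim := ENNReal.Tendsto.const_mul (a := (m : ℝ≥0∞)) (tendsto_lintegral_seqRemainder hθ)
      (Or.inr (ENNReal.natCast_ne_top m))
    have hlim2 := hlim.const_add (∑' i, ∫⁻ y, ENNReal.ofReal (y i) * h (y i) (seqErase i y)
      ∂gemMeasure θ hθ)
    rw [mul_zero, add_zero] at hlim2
    refine ge_of_tendsto' hlim2 fun n => ?_
    rw [← sizeBiased_partial hθ n (hmin m)]
    refine add_le_add ?_ ?_
    · refine (Finset.sum_le_sum fun i _ => lintegral_mono fun y => ?_).trans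
        (ENNReal.sum_le_tsum (Finset.range n))
      exact mul_le_mul_right (min_le_left _ _) _
    · rw [← lintegral_const_mul _ (measurable_seqRemainder n)]
      refine lintegral_mono fun y => ?_
      change seqRemainder n y * _ ≤ m * seqRemainder n y
      rw [mul_comm]
      exact mul_le_mul_left (min_le_right _ _) _

end

section

/-! ### Sums over tuples of distinct indices of a GEM sequence -/

/-- The sum of `G (y_{i₁}, …, y_{i_k}) s` over `k`-tuples of distinct indices, where `s` is the
sequence of the remaining terms of `y`. -/
noncomputable def palmSum : (k : ℕ) → ((Fin k → ℝ) → (ℕ → ℝ) → ℝ≥0∞) → (ℕ → ℝ) → ℝ≥0∞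
  | 0, G, y => G Fin.elim0 y
  | k + 1, G, y => ∑' i, palmSum k (fun z s => G (Fin.cons (y i) z) s) (seqErase i y)

/-- The density of the `k`-th correlation measure of the Poisson-Dirichlet process. -/
noncomputable def palmWeight (θ : ℝ) {k : ℕ} (z : Fin k → ℝ) : ℝ≥0∞ :=
  {z : Fin k → ℝ | (∀ l, 0 < z l) ∧ ∑ l, z l < 1}.indicator
    (fun z => ENNReal.ofReal (θ ^ k / (∏ l, z l) * (1 - ∑ l, z l) ^ (θ - 1))) z

theorem measurableSet_posOrthant (k : ℕ) : MeasurableSet (posOrthant k) := by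
  rw [posOrthant, ofPred_forall]
  exact MeasurableSet.iInter fun l => measurableSet_lt measurable_const (measurable_pi_apply l)

@[fun_prop]
theorem measurable_palmWeight (θ : ℝ) (k : ℕ) :
    Measurable fun z : Fin k → ℝ => palmWeight θ z := by
  refine Measurable.indicator (by fun_prop) ?_
  exact (measurableSet_posOrthant k).inter 
    (measurableSet_lt (f := fun z : Fin k → ℝ => ∑ l, z l) (by fun_prop) measurable_const)

@[fun_prop]
theorem measurable_finCons {α : Type*} [MeasurableSpace α] {k : ℕ} {f : α → ℝ}
    {g : α → Fin k → ℝ} (hf : Measurable f) (hg : Measurable g) :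
    Measurable fun a => (Fin.cons (f a) (g a) : Fin (k + 1) → ℝ) := by
  refine measurable_pi_lambda _ fun l => ?_
  refine Fin.cases ?_ (fun l => ?_) l
  · simpa using hf
  · simp only [Fin.cons_succ]
    fun_prop

/-- The parameter space is arbitrary because each level of the recursion turns the chosen term `y i`
into a parameter of the next. -/
theorem measurable_palmSum (k : ℕ) : ∀ {α : Type} [MeasurableSpace α]
    {G : α → (Fin k → ℝ) → (ℕ → ℝ) → ℝ≥0∞},
    (Measurable fun p : α × (Fin k → ℝ) × (ℕ → ℝ) => G p.1 p.2.1 p.2.2) →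
    Measurable fun p : α × (ℕ → ℝ) => palmSum k (G p.1) p.2 := by
  induction k with
  | zero =>
    intro α _ G hG
    simp only [palmSum]
    fun_prop
  | succ k ih =>
    intro α _ G hG
    simp only [palmSum]
    refine Measurable.tsum fun i => ?_
    have h := ih (α := α × (ℕ → ℝ)) (G := fun a z s => G a.1 (Fin.cons (a.2 i) z) s) (by fun_prop)
    exact h.comp (by fun_prop : Measurable fun p : α × (ℕ → ℝ) => (p, seqErase i p.2))

theorem smul_finCons {k : ℕ} (c x : ℝ) (z : Fin k → ℝ) :
    c • (Fin.cons x z : Fin (k + 1) → ℝ) = Fin.cons (c * x) (c • z) := by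
  funext l
  refine Fin.cases ?_ (fun l => ?_) l <;> simp

theorem palmSum_smul (k : ℕ) (G : (Fin k → ℝ) → (ℕ → ℝ) → ℝ≥0∞) (c : ℝ) (y : ℕ → ℝ) :
    palmSum k G (c • y) = palmSum k (fun z s => G (c • z) (c • s)) y := by
  induction k generalizing y with
  | zero =>
    simp only [palmSum]
    congr 1
    exact Subsingleton.elim _ _
  | succ k ih =>
    simp only [palmSum, seqErase_smul, ih, smul_finCons, Pi.smul_apply, smul_eq_mul]

theorem lintegral_finCons {k : ℕ} {f : (Fin (k + 1) → ℝ) → ℝ≥0∞} (hf : Measurable f) :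
    ∫⁻ z, f z = ∫⁻ x, ∫⁻ z : Fin k → ℝ, f (Fin.cons x z) := by
  have h := (volume_preserving_piFinSuccAbove (fun _ : Fin (k + 1) => ℝ) 0).symm
  rw [← h.lintegral_comp hf, Measure.volume_eq_prod, lintegral_prod]
  · refine lintegral_congr fun x => lintegral_congr fun z => ?_
    simp [MeasurableEquiv.piFinSuccAbove]
    rfl
  · exact (hf.comp h.measurable).aemeasurable

variable {θ : ℝ}

/-- One pick in terms of densities: the Beta density over `x`, times the weight of the other `k`
points rescaled by `1 - x`, with Jacobian `(1 - x)^k`. -/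
theorem palmWeight_cons (hθ : 0 < θ) {k : ℕ} {x : ℝ} (hx : x ∈ Ioo (0 : ℝ) 1) (z : Fin k → ℝ) :
    ENNReal.ofReal ((1 - x) ^ k) * palmWeight θ (Fin.cons x ((1 - x) • z) : Fin (k + 1) → ℝ) =
      ENNReal.ofReal (θ * (1 - x) ^ (θ - 1)) * (ENNReal.ofReal x)⁻¹ * palmWeight θ z := by
  have h1 : 0 < 1 - x := sub_pos.2 hx.2
  have hx0 : 0 < x := hx.1
  have hsum : ∑ l, (Fin.cons x ((1 - x) • z) : Fin (k + 1) → ℝ) l = x + (1 - x) * ∑ l, z l := by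
    simp [Fin.sum_univ_succ, Finset.mul_sum]
  have hprod : ∏ l, (Fin.cons x ((1 - x) • z) : Fin (k + 1) → ℝ) l =
      x * ((1 - x) ^ k * ∏ l, z l) := by
    simp [Fin.prod_univ_succ, Finset.prod_mul_distrib]
  have hiff : (Fin.cons x ((1 - x) • z) : Fin (k + 1) → ℝ) ∈
      {z : Fin (k + 1) → ℝ | (∀ l, 0 < z l) ∧ ∑ l, z l < 1} ↔
      z ∈ {z : Fin k → ℝ | (∀ l, 0 < z l) ∧ ∑ l, z l < 1} := by
    simp only [mem_ofPred_eq, hsum, Fin.forall_fin_succ, Fin.cons_zero, Fin.cons_succ,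
      Pi.smul_apply, smul_eq_mul, mul_pos_iff_of_pos_left h1, hx0, true_and]
    refine and_congr_right fun _ => ⟨fun h => by nlinarith, fun h => by nlinarith⟩
  unfold palmWeight
  by_cases hz : z ∈ {z : Fin k → ℝ | (∀ l, 0 < z l) ∧ ∑ l, z l < 1}
  · rw [indicator_of_mem (hiff.2 hz), indicator_of_mem hz, hsum, hprod,
      ← ENNReal.ofReal_inv_of_pos hx0, ← ENNReal.ofReal_mul (by positivity),
      ← ENNReal.ofReal_mul (by positivity), ← ENNReal.ofReal_mul (by positivity)]
    congr 1
    have hz1 : 0 < 1 - ∑ l, z l := sub_pos.2 hz.2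
    have hp : ∏ l, z l ≠ 0 := (Finset.prod_pos fun l _ => hz.1 l).ne'
    rw [show 1 - (x + (1 - x) * ∑ l, z l) = (1 - x) * (1 - ∑ l, z l) by ring,
      Real.mul_rpow h1.le hz1.le]
    field_simp
    ring
  · rw [indicator_of_notMem (fun h => hz (hiff.1 h)), indicator_of_notMem hz, mul_zero, mul_zero]

theorem palmWeight_cons_of_notMem {k : ℕ} {x : ℝ} (hx : x ∉ Ioo (0 : ℝ) 1) (z : Fin k → ℝ) :
    palmWeight θ (Fin.cons x z : Fin (k + 1) → ℝ) = 0 := by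
  refine indicator_of_notMem (fun h => hx ⟨by simpa using h.1 0, ?_⟩) _
  have h2 := h.2
  rw [Fin.sum_univ_succ] at h2
  have h3 : 0 ≤ ∑ l : Fin k, (Fin.cons x z : Fin (k + 1) → ℝ) l.succ :=
    Finset.sum_nonneg fun l _ => (h.1 l.succ).le
  simp only [Fin.cons_zero] at h2
  linarith

/-- A plain sum over `i` is a size-biased sum of the summand divided by `y i`. After this pick the
other terms are `1 - x` times a GEM sequence, to which the case `k` applies; the remaining masses
multiply to `1 - |z|`. -/
theorem lintegral_palmSum (hθ : 0 < θ) (k : ℕ) : ∀ {G : (Fin k → ℝ) → (ℕ → ℝ) → ℝ≥0∞},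
    Measurable (Function.uncurry G) →
    ∫⁻ y, palmSum k G y ∂gemMeasure θ hθ =
      ∫⁻ z, palmWeight θ z * ∫⁻ y, G z ((1 - ∑ l, z l) • y) ∂gemMeasure θ hθ := by
  have := isProbabilityMeasure_gemMeasure hθ
  induction k with
  | zero =>
    intro G hG
    have hw : palmWeight θ (default : Fin 0 → ℝ) = 1 := by
      unfold palmWeight
      rw [indicator_of_mem (by simp)]
      simp
    rw [Measure.volume_pi_eq_dirac (default : Fin 0 → ℝ), lintegral_dirac' _ (by fun_prop), hw]
    simp only [palmSum, Finset.univ_eq_empty, Finset.sum_empty, sub_zero, one_smul, one_mul,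
      Subsingleton.elim (default : Fin 0 → ℝ) Fin.elim0]
  | succ k ih =>
    intro G hG
    let h : ℝ → (ℕ → ℝ) → ℝ≥0∞ := fun x s =>
      (ENNReal.ofReal x)⁻¹ * palmSum k (fun z s => G (Fin.cons x z) s) s
    have hh : Measurable (Function.uncurry h) :=
      Measurable.mul (by fun_prop)
        (measurable_palmSum k (G := fun x z s => G (Fin.cons x z) s) (by fun_prop))
    have e1 : ∫⁻ y, palmSum (k + 1) G y ∂gemMeasure θ hθ =
        ∫⁻ y, ∑' i, ENNReal.ofReal (y i) * h (y i) (seqErase i y) ∂gemMeasure θ hθ := by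
      refine lintegral_congr_ae ?_
      filter_upwards [ae_gemMeasure hθ] with y hy
      simp only [palmSum, h]
      refine tsum_congr fun i => ?_
      rw [← mul_assoc, ENNReal.mul_inv_cancel (ENNReal.ofReal_pos.2 (hy.1 i)).ne'
        ENNReal.ofReal_ne_top, one_mul]
    have hm : Measurable fun z : Fin (k + 1) → ℝ =>
        palmWeight θ z * ∫⁻ y, G z ((1 - ∑ l, z l) • y) ∂gemMeasure θ hθ := by fun_prop
    rw [e1, lintegral_sizeBiased hθ hh, lintegral_gemMeasure hθ, lintegral_betaMeasure_one hθ,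
      lintegral_finCons hm]
    rotate_left
    · exact Measurable.lintegral_prod_right (hh.comp
        (by fun_prop : Measurable fun p : ℝ × (ℕ → ℝ) => (p.1,
          seqErase 0 (seqCons p.1 ((1 - p.1) • p.2)))))
    · fun_prop
    refine lintegral_congr fun x => ?_
    by_cases hx : x ∈ Ioo (0 : ℝ) 1
    · have h1 : 0 < 1 - x := sub_pos.2 hx.2
      rw [indicator_of_mem hx]
      simp only [seqCons_zero, seqErase_zero_seqCons, h, palmSum_smul]
      have e2 := lintegral_comp_smul_of_pos (volume : Measure (Fin k → ℝ))
        (hm.comp (by fun_prop : Measurable fun z => (Fin.cons x z : Fin (k + 1) → ℝ))) h1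
      simp only [Function.comp_apply] at e2
      rw [lintegral_const_mul, ih (by fun_prop), ← e2, Module.finrank_fin_fun, ← mul_assoc, ← lintegral_const_mul, ← lintegral_const_mul]
      rotate_left
      · fun_prop
      · fun_prop
      · exact (measurable_palmSum k (α := Unit)
          (G := fun _ z s => G (Fin.cons x ((1 - x) • z)) ((1 - x) • s)) (by fun_prop)).comp
          (by fun_prop : Measurable fun s : ℕ → ℝ => ((), s))
      refine lintegral_congr fun z => ?_
      rw [← mul_assoc, ← mul_assoc, palmWeight_cons hθ hx]
      congr 1
      refine lintegral_congr fun y => ?_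
      rw [smul_smul]
      congr 2
      simp only [Fin.sum_univ_succ, Fin.cons_zero, Fin.cons_succ, Pi.smul_apply, smul_eq_mul,
        ← Finset.mul_sum]
      ring
    · rw [indicator_of_notMem hx, zero_mul]
      simp only [palmWeight_cons_of_notMem hx, zero_mul, lintegral_zero]

end

/-! ### Configurations of real sequences -/

/-- The terms of `y` accumulate at most at `0` from above. -/
def TermsLocallyFinite (y : ℕ → ℝ) : Prop := ∀ a : ℝ, 0 < a → {i | a ≤ y i}.Finite

theorem TermsLocallyFinite.of_summable {y : ℕ → ℝ} (hy : Summable y) : TermsLocallyFinite y := by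
  intro a ha
  have h := hy.tendsto_cofinite_zero.eventually (gt_mem_nhds ha)
  simpa [Filter.eventually_cofinite] using h

/-- `j ↦ j` for `j < i` and `j ↦ j + 1` for `i ≤ j`. -/
def skipNat (i j : ℕ) : ℕ := if j < i then j else j + 1

theorem skipNat_injective (i : ℕ) : Function.Injective (skipNat i) := by
  intro a b h
  unfold skipNat at h
  split_ifs at h <;> omega

theorem skipNat_ne (i j : ℕ) : skipNat i j ≠ i := by
  unfold skipNat; split_ifs <;> omega

theorem exists_skipNat_eq {i n : ℕ} (h : n ≠ i) : ∃ j, skipNat i j = n := by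
  rcases lt_or_gt_of_ne h with h | h
  · exact ⟨n, by simp [skipNat, h]⟩
  · exact ⟨n - 1, by unfold skipNat; split_ifs <;> omega⟩

theorem seqErase_apply (i : ℕ) (y : ℕ → ℝ) (j : ℕ) : seqErase i y j = y (skipNat i j) := rfl

theorem TermsLocallyFinite.seqErase {y : ℕ → ℝ} (hy : TermsLocallyFinite y) (i : ℕ) :
    TermsLocallyFinite (seqErase i y) := fun a ha =>
  (hy a ha).preimage (f := skipNat i) (skipNat_injective i).injOn

theorem tsum_seqErase (f : ℝ → ℝ≥0∞) (i : ℕ) (y : ℕ → ℝ) :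
    ∑' j, f (y j) = f (y i) + ∑' j, f (seqErase i y j) := by
  induction i generalizing y with
  | zero => exact tsum_eq_zero_add' ENNReal.summable
  | succ i ih =>
    rw [tsum_eq_zero_add' ENNReal.summable, ih fun n => y (n + 1),
      tsum_eq_zero_add' (f := fun j => f (seqErase (i + 1) y j)) ENNReal.summable]
    have h0 : seqErase (i + 1) y 0 = y 0 := by simp [_root_.seqErase]
    have h1 : ∀ j, seqErase (i + 1) y (j + 1) = seqErase i (fun n => y (n + 1)) j := fun j => by
      by_cases h : j < i <;> simp [_root_.seqErase, h]
    simp only [h0, h1]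
    rw [add_left_comm]

/-- A tuple of `k + 1` distinct indices is a first index `i` together with a tuple of `k` distinct
indices of the sequence without its `i`-th term, renumbered by `skipNat i`. -/
theorem tsum_embedding_succ {k : ℕ} (F : (Fin (k + 1) → ℝ) → ℝ≥0∞) (y : ℕ → ℝ) :
    ∑' e : Fin (k + 1) ↪ ℕ, F (fun l => y (e l)) =
      ∑' i, ∑' e : Fin k ↪ ℕ, F (Fin.cons (y i) fun l => seqErase i y (e l)) := by
  let g : ℕ × (Fin k ↪ ℕ) → (Fin (k + 1) ↪ ℕ) := fun p =>
    ⟨Fin.cons p.1 fun l => skipNat p.1 (p.2 l), Fin.cons_injective_iff.2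
      ⟨by rintro ⟨l, hl⟩; exact skipNat_ne _ _ hl, (skipNat_injective _).comp p.2.injective⟩⟩
  have hg : Function.Bijective g := by
    constructor
    · rintro ⟨i, e⟩ ⟨i', e'⟩ h
      have h' : ∀ l, g (i, e) l = g (i', e') l := fun l => by rw [h]
      have h0 : i = i' := h' 0
      subst h0
      have : e = e' := by
        ext l
        exact skipNat_injective i (by simpa [g] using h' l.succ)
      rw [this]
    · intro e
      have hne : ∀ l : Fin k, e l.succ ≠ e 0 := fun l h => Fin.succ_ne_zero l (e.injective h)
      choose e' he' using fun l => exists_skipNat_eq (hne l)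
      refine ⟨(e 0, ⟨e', fun a b hab => ?_⟩), ?_⟩
      · have : e a.succ = e b.succ := by rw [← he' a, ← he' b, hab]
        exact Fin.succ_injective _ (e.injective this)
      · ext l
        refine Fin.cases ?_ (fun l => ?_) l
        · simp [g]
        · exact he' l
  refine ((Equiv.ofBijective g hg).tsum_eq _).symm.trans
    ((ENNReal.tsum_prod (f := fun i e => F fun l => y (g (i, e) l))).trans ?_)
  refine tsum_congr fun i => tsum_congr fun e => congrArg F ?_
  funext l
  refine Fin.cases ?_ (fun l => ?_) l
  · simp [g]
  · simp [g, seqErase_apply]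

open Classical in
/-- The configuration of the positive terms of a sequence (empty if these accumulate at a
positive number). -/
noncomputable def seqConfig (y : ℕ → ℝ) : PointConfig :=
  if h : TermsLocallyFinite y then
    ⟨(Measure.sum fun i => Measure.dirac (y i)).restrict (Ioi 0), isPointConfig_sum_dirac y h⟩
  else ⟨0, by simp, fun _ _ _ _ _ _ => ⟨0, by simp⟩⟩

theorem seqConfig_val {y : ℕ → ℝ} (hy : TermsLocallyFinite y) :
    (seqConfig y).1 = (Measure.sum fun i => Measure.dirac (y i)).restrict (Ioi 0) := by
  rw [seqConfig, dif_pos hy]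

theorem configOfSeq_eq (z : RankedCone) : configOfSeq z = seqConfig z :=
  Subtype.ext (seqConfig_val (.of_summable z.2.2.2.1)).symm

theorem measurable_sum_dirac_restrict {α β ι : Type*} [MeasurableSpace α] [MeasurableSpace β]
    [Countable ι] {f : ι → α → β} (hf : ∀ i, Measurable (f i)) {s : Set β} (hs : MeasurableSet s) :
    Measurable fun a => (Measure.sum fun i => Measure.dirac (f i a)).restrict s := by
  refine Measure.measurable_of_measurable_coe _ fun t ht => ?_
  have : ∀ a, (Measure.sum fun i => Measure.dirac (f i a)).restrict s t =
      ∑' i, (t ∩ s).indicator 1 (f i a) := fun a => by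
    rw [Measure.restrict_apply ht, Measure.sum_apply _ (ht.inter hs)]
    exact tsum_congr fun i => Measure.dirac_apply' _ (ht.inter hs)
  simp only [this]
  exact Measurable.tsum fun i => (measurable_one.indicator (ht.inter hs)).comp (hf i)

/-- The thresholds `1 / (n + 1)` suffice, and finitely many exceedances means none from some index
on. -/
theorem measurableSet_termsLocallyFinite : MeasurableSet {y : ℕ → ℝ | TermsLocallyFinite y} := by
  have : {y : ℕ → ℝ | TermsLocallyFinite y} =
      ⋂ n : ℕ, ⋃ N : ℕ, ⋂ i : ℕ, {y | N ≤ i → y i < 1 / ((n : ℝ) + 1)} := by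
    ext y
    simp only [mem_ofPred_eq, mem_iInter, mem_iUnion]
    constructor
    · intro h n
      obtain ⟨N, hN⟩ := (h (1 / ((n : ℝ) + 1)) (by positivity)).bddAbove
      refine ⟨N + 1, fun i hi => ?_⟩
      by_contra hlt
      have := hN (show i ∈ {i | _ ≤ y i} from not_lt.1 hlt)
      omega
    · intro h a ha
      obtain ⟨n, hn⟩ := exists_nat_one_div_lt ha
      obtain ⟨N, hN⟩ := h n
      refine (Set.finite_lt_nat N).subset fun i hi => ?_
      by_contra hlt
      have h1 := hN i (not_lt.1 hlt)
      have h2 : a ≤ y i := hi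
      linarith
  rw [this]
  refine MeasurableSet.iInter fun n => MeasurableSet.iUnion fun N => MeasurableSet.iInter fun i => ?_
  by_cases h : N ≤ i
  · simpa [h] using measurableSet_lt (measurable_pi_apply i) measurable_const
  · simp [h]

@[fun_prop]
theorem measurable_seqConfig : Measurable seqConfig := by
  classical
  have h : Measurable fun y => (seqConfig y).1 := by
    have : (fun y => (seqConfig y).1) = fun y => if TermsLocallyFinite y then
        (Measure.sum fun i => Measure.dirac (y i)).restrict (Ioi 0) else 0 := by
      funext y
      by_cases hy : TermsLocallyFinite y
      · rw [seqConfig_val hy, if_pos hy]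
      · rw [if_neg hy, seqConfig, dif_neg hy]
    rw [this]
    exact Measurable.ite measurableSet_termsLocallyFinite
      (measurable_sum_dirac_restrict (fun i => measurable_pi_apply i) measurableSet_Ioi)
      measurable_const
  exact h.subtype_mk

@[fun_prop]
theorem measurable_addAtoms {α : Type*} [MeasurableSpace α] {k : ℕ} {f : α → PointConfig}
    {g : α → Fin k → ℝ} (hf : Measurable f) (hg : Measurable g) :
    Measurable fun a => addAtoms (f a) (g a) := by
  refine Measurable.subtype_mk (Measure.measurable_of_measurable_coe _ fun s hs => ?_)
  simp only [Measure.add_apply]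
  exact ((Measure.measurable_coe hs).comp (measurable_subtype_coe.comp hf)).add
    ((Measure.measurable_coe hs).comp (measurable_sum_dirac_restrict
      (fun l => (measurable_pi_apply l).comp hg) measurableSet_Ioi))

@[fun_prop]
theorem measurable_factorialMeasure (k : ℕ) : Measurable (factorialMeasure k) :=
  have : Countable (Fin k ↪ ℕ) := DFunLike.coe_injective.countable
  measurable_sum_dirac_restrict (by fun_prop) (measurableSet_posOrthant k)

theorem lintegral_factorialMeasure {k : ℕ} (y : ℕ → ℝ) {g : (Fin k → ℝ) → ℝ≥0∞}
    (hg : Measurable g) :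
    ∫⁻ z, g z ∂factorialMeasure k y =
      ∑' e : Fin k ↪ ℕ, (posOrthant k).indicator g fun l => y (e l) := by
  have hm := measurableSet_posOrthant k
  rw [factorialMeasure, ← lintegral_indicator hm, lintegral_sum_measure]
  exact tsum_congr fun e => lintegral_dirac' _ (hg.indicator hm)

theorem addAtoms_finCons (η : PointConfig) {k : ℕ} (x : ℝ) (z : Fin k → ℝ) :
    addAtoms η (Fin.cons x z : Fin (k + 1) → ℝ) = addAtoms (addAtoms η z) fun _ : Fin 1 => x := by
  refine Subtype.ext ?_
  simp only [addAtoms]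
  rw [add_assoc, ← Measure.restrict_add]
  congr 2
  ext s hs
  simp only [Measure.add_apply, Measure.sum_fintype, Measure.finsetSum_apply, Fin.sum_univ_succ,
    Fin.cons_zero, Fin.cons_succ, Finset.univ_eq_empty, Finset.sum_empty, add_zero]
  rw [add_comm]

theorem addAtoms_elim0 (η : PointConfig) (z : Fin 0 → ℝ) : addAtoms η z = η := by
  refine Subtype.ext ?_
  simp [addAtoms]

theorem addAtoms_seqErase {y : ℕ → ℝ} (hy : TermsLocallyFinite y) (i : ℕ) :
    addAtoms (seqConfig (seqErase i y)) (fun _ : Fin 1 => y i) = seqConfig y := by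
  refine Subtype.ext ?_
  simp only [addAtoms]
  rw [seqConfig_val hy, seqConfig_val (hy.seqErase i), ← Measure.restrict_add]
  congr 1
  ext s hs
  simp only [Measure.add_apply, Measure.sum_apply _ hs, tsum_fintype, Finset.univ_unique,
    Finset.sum_singleton]
  rw [tsum_seqErase (fun x => Measure.dirac x s) i y, add_comm]

/-- Restoring the deleted terms as atoms gives back the full configuration at every summand. This
links the recursive `palmSum` to the factorial measure. -/
theorem palmSum_addAtoms (k : ℕ) : ∀ (K : (Fin k → ℝ) → PointConfig → ℝ≥0∞) {y : ℕ → ℝ},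
    TermsLocallyFinite y → palmSum k (fun z s => K z (addAtoms (seqConfig s) z)) y =
      ∑' e : Fin k ↪ ℕ, K (fun l => y (e l)) (seqConfig y) := by
  induction k with
  | zero =>
    intro K y _
    rw [tsum_eq_single (Function.Embedding.ofIsEmpty) fun e he => absurd (Subsingleton.elim _ _) he]
    simp only [palmSum, addAtoms_elim0]
    congr 1
    exact Subsingleton.elim _ _
  | succ k ih =>
    intro K y hy
    rw [tsum_embedding_succ fun z => K z (seqConfig y)]
    simp only [palmSum, addAtoms_finCons]
    refine tsum_congr fun i => ?_
    rw [ih (fun z ζ => K (Fin.cons (y i) z) (addAtoms ζ fun _ : Fin 1 => y i)) (hy.seqErase i)]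
    simp only [addAtoms_seqErase hy]

section

/-! ### The decreasing rearrangement is a permutation -/

/-- The counts above all positive levels determine the finite multiplicity of each value, as a
difference of the counts at `a` and just below it. Bijections between the fibres of `u` and `w` are
then glued. -/
theorem exists_equiv_comp_eq {u w : ℕ → ℝ} (hu : ∀ n, 0 < u n) (hw : ∀ n, 0 < w n)
    (hfu : ∀ a : ℝ, 0 < a → {n | a < u n}.Finite) (hfw : ∀ a : ℝ, 0 < a → {n | a < w n}.Finite)
    (hcard : ∀ a : ℝ, 0 < a → {n | a < u n}.ncard = {n | a < w n}.ncard) :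
    ∃ σ : ℕ ≃ ℕ, ∀ n, u n = w (σ n) := by
  have hgap : ∀ {v : ℕ → ℝ} {a : ℝ}, 0 < a → (∀ a : ℝ, 0 < a → {n | a < v n}.Finite) →
      ∀ᶠ b in nhdsWithin a (Iio a), {n | v n = a} = {n | b < v n} \ {n | a < v n} := by
    intro v a ha hv
    -- Only finitely many terms exceed `a / 2`, so for `b` close below `a` no term lies in `[b, a)`.
    have h1 : ∀ᶠ b in nhdsWithin a (Iio a), ∀ n ∈ {n | a / 2 < v n}, v n < a → v n < b := by
      rw [Filter.eventually_all_finite (hv _ (half_pos ha))]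
      intro n _
      by_cases h : v n < a
      · filter_upwards [Ioo_mem_nhdsLT h] with b hb _ using hb.1
      · exact Filter.Eventually.of_forall fun _ h' => absurd h' h
    filter_upwards [h1, Ioo_mem_nhdsLT (half_lt_self ha)] with b hb hab
    ext n
    simp only [mem_ofPred_eq, mem_sdiff, not_lt]
    constructor
    · intro h
      exact ⟨by rw [h]; exact hab.2, h.le⟩
    · rintro ⟨h, h'⟩
      by_contra hne
      exact lt_asymm h (hb n (hab.1.trans h) (lt_of_le_of_ne h' hne))
  have hequiv : ∀ a : ℝ, Nonempty ({n // u n = a} ≃ {n // w n = a}) := by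
    intro a
    by_cases ha : 0 < a
    · obtain ⟨b, ⟨hbu, hbw⟩, hb⟩ := (((hgap ha hfu).and (hgap ha hfw)).and
        (Ioo_mem_nhdsLT ha)).exists
      have hc : {n | u n = a}.ncard = {n | w n = a}.ncard := by
        rw [hbu, hbw, ncard_sdiff (show {n | a < u n} ⊆ {n | b < u n} from fun n hn => hb.2.trans hn) (hfu a ha),
          ncard_sdiff (show {n | a < w n} ⊆ {n | b < w n} from fun n hn => hb.2.trans hn) (hfw a ha), hcard a ha, hcard b hb.1]
      have fu : Finite {n // u n = a} := by
        have : {n | u n = a}.Finite := by rw [hbu]; exact (hfu b hb.1).sdiff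
        exact this.to_subtype
      have fw : Finite {n // w n = a} := by
        have : {n | w n = a}.Finite := by rw [hbw]; exact (hfw b hb.1).sdiff
        exact this.to_subtype
      exact Finite.card_eq.1 hc
    · have e1 : IsEmpty {n // u n = a} := ⟨fun n => ha (n.2 ▸ hu n)⟩
      have e2 : IsEmpty {n // w n = a} := ⟨fun n => ha (n.2 ▸ hw n)⟩
      exact ⟨Equiv.equivOfIsEmpty _ _⟩
  have e := fun a => (hequiv a).some
  refine ⟨((Equiv.sigmaFiberEquiv u).symm.trans (Equiv.sigmaCongrRight e)).trans
    (Equiv.sigmaFiberEquiv w), fun n => ?_⟩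
  exact ((e (u n)) ⟨n, rfl⟩).2.symm

/-- The minimum over a set of `n + 1` indices exceeds `a` exactly when all these terms do.
Boundedness keeps the real supremum from taking its default value. -/
theorem lt_decreasingRearrangement_iff {y : ℕ → ℝ} (hy : BddAbove (range y)) {a : ℝ}
    (hfin : {j | a < y j}.Finite) (n : ℕ) :
    a < decreasingRearrangement y n ↔ n < {j | a < y j}.ncard := by
  have hne : ∀ S : {S : Finset ℕ // S.card = n + 1}, Nonempty S.1 := fun S => by
    have : S.1.Nonempty := Finset.card_pos.1 (by rw [S.2]; omega)
    exact this.to_subtype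
  have hinf : ∀ S : {S : Finset ℕ // S.card = n + 1},
      a < ⨅ i : S.1, y i ↔ ∀ i ∈ S.1, a < y i := by
    intro S
    have := hne S
    constructor
    · intro h i hi
      exact h.trans_le (ciInf_le (Set.finite_range _).bddBelow (⟨i, hi⟩ : S.1))
    · intro h
      obtain ⟨i, hi⟩ := exists_eq_ciInf_of_finite (f := fun i : S.1 => y i)
      rw [← hi]
      exact h i i.2
  have hbdd : BddAbove (range fun S : {S : Finset ℕ // S.card = n + 1} => ⨅ i : S.1, y i) := by
    obtain ⟨C, hC⟩ := hy
    refine ⟨C, ?_⟩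
    rintro _ ⟨S, rfl⟩
    obtain ⟨i⟩ := hne S
    exact (ciInf_le (Set.finite_range _).bddBelow i).trans (hC ⟨i, rfl⟩)
  have : Nonempty {S : Finset ℕ // S.card = n + 1} := ⟨⟨Finset.range (n + 1), by simp⟩⟩
  rw [decreasingRearrangement, lt_ciSup_iff hbdd]
  simp only [hinf]
  rw [← Nat.succ_le_iff, ncard_eq_toFinset_card _ hfin]
  constructor
  · rintro ⟨S, hS⟩
    rw [Nat.succ_eq_add_one, ← S.2]
    exact Finset.card_le_card fun i hi => by simpa using hS i hi
  · intro h
    obtain ⟨S, hS, hc⟩ := Finset.exists_subset_card_eq h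
    exact ⟨⟨S, hc⟩, fun i hi => by simpa using hS hi⟩

theorem exists_equiv_decreasingRearrangement {y : ℕ → ℝ} (hpos : ∀ i, 0 < y i)
    (hsum : Summable y) : ∃ σ : ℕ ≃ ℕ, decreasingRearrangement y = fun n => y (σ n) := by
  have hbdd : BddAbove (range y) := hsum.tendsto_atTop_zero.bddAbove_range
  have hfin : ∀ a : ℝ, 0 < a → {j | a < y j}.Finite := fun a ha =>
    (TermsLocallyFinite.of_summable hsum a ha).subset fun j hj => (show a < y j from hj).le
  have hset : ∀ a : ℝ, 0 < a →
      {n | a < decreasingRearrangement y n} = Iio {j | a < y j}.ncard := fun a ha => by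
    ext n; exact lt_decreasingRearrangement_iff hbdd (hfin a ha) n
  have hposD : ∀ n, 0 < decreasingRearrangement y n := by
    intro n
    obtain ⟨i, _, hi⟩ := (Finset.range (n + 1)).exists_min_image y ⟨0, by simp⟩
    -- Half the least of the first `n + 1` terms is a level exceeded by at least `n + 1` terms.
    have ha := half_pos (hpos i)
    refine ha.trans ((lt_decreasingRearrangement_iff hbdd (hfin _ ha) n).2 ?_)
    rw [ncard_eq_toFinset_card _ (hfin _ ha), ← Nat.succ_le_iff, Nat.succ_eq_add_one,
      ← Finset.card_range (n + 1)]
    refine Finset.card_le_card fun j hj => ?_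
    have := hi j hj
    have := hpos i
    simp only [Finite.mem_toFinset, mem_ofPred_eq]
    linarith
  obtain ⟨σ, hσ⟩ := exists_equiv_comp_eq hposD hpos
    (fun a ha => by rw [hset a ha]; exact finite_Iio _) hfin
    (fun a ha => by rw [hset a ha, ncard_eq_toFinset_card', toFinset_Iio, Nat.card_Iio])
  exact ⟨σ, funext hσ⟩

/-! ### The Palm formula for the Poisson-Dirichlet process -/

theorem termsLocallyFinite_comp_equiv (σ : ℕ ≃ ℕ) (y : ℕ → ℝ) :
    TermsLocallyFinite (fun n => y (σ n)) ↔ TermsLocallyFinite y := by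
  refine forall₂_congr fun a _ => ?_
  constructor
  · intro h
    simpa using h.preimage (f := σ.symm) σ.symm.injective.injOn
  · intro h
    exact h.preimage (f := σ) σ.injective.injOn

theorem seqConfig_comp_equiv (σ : ℕ ≃ ℕ) (y : ℕ → ℝ) :
    seqConfig (fun n => y (σ n)) = seqConfig y := by
  by_cases hy : TermsLocallyFinite y
  · refine Subtype.ext ?_
    rw [seqConfig_val hy, seqConfig_val ((termsLocallyFinite_comp_equiv σ y).2 hy)]
    congr 1
    exact Measure.sum_comp_equiv σ fun n => Measure.dirac (y n)
  · rw [seqConfig, seqConfig, dif_neg hy, dif_neg (fun h => hy ((termsLocallyFinite_comp_equiv σ y).1 h))]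

theorem factorialMeasure_comp_equiv (k : ℕ) (σ : ℕ ≃ ℕ) (y : ℕ → ℝ) :
    factorialMeasure k (fun n => y (σ n)) = factorialMeasure k y := by
  rw [factorialMeasure, factorialMeasure]
  congr 1
  exact Measure.sum_comp_equiv (Equiv.embeddingCongr (Equiv.refl (Fin k)) σ)
    fun e : Fin k ↪ ℕ => Measure.dirac fun l => y (e l)

variable {Ω : Type*} [MeasurableSpace Ω] {P : Measure Ω} {θ : ℝ} {X : Ω → RankedSimplex}

/-- The ranking is almost surely a permutation of the GEM sequence, so it is invisible to a
permutation-invariant functional. -/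
theorem lintegral_poissonDirichlet (hθ : 0 < θ) (hX : Measurable X)
    (hPD : P.map (fun ω => (X ω : ℕ → ℝ)) = poissonDirichlet θ hθ)
    {F : (ℕ → ℝ) → ℝ≥0∞} (hF : Measurable F)
    (hinv : ∀ (σ : ℕ ≃ ℕ) y, F (fun n => y (σ n)) = F y) :
    ∫⁻ ω, F (X ω : ℕ → ℝ) ∂P = ∫⁻ y, F y ∂gemMeasure θ hθ := by
  rw [← lintegral_map hF (g := fun ω => (X ω : ℕ → ℝ)) (μ := P) (measurable_subtype_coe.comp hX),
    hPD, poissonDirichlet,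
    lintegral_map hF measurable_decreasingRearrangement]
  refine lintegral_congr_ae ?_
  filter_upwards [ae_gemMeasure hθ] with y hy
  obtain ⟨σ, hσ⟩ := exists_equiv_decreasingRearrangement hy.1 hy.2
  rw [hσ, hinv]

/-- The density of the `k`-th correlation measure of the Poisson-Dirichlet process with total
mass `v`. -/
noncomputable def scaledPalmWeight (θ v : ℝ) {k : ℕ} (z : Fin k → ℝ) : ℝ≥0∞ :=
  {p : ℝ × (Fin k → ℝ) | (∀ l, 0 < p.2 l) ∧ ∑ l, p.2 l < p.1}.indicator
    (fun p => ENNReal.ofReal (θ ^ k / (∏ l, p.2 l) * (1 - (∑ l, p.2 l) / p.1) ^ (θ - 1))) (v, z)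

@[fun_prop]
theorem measurable_scaledPalmWeight (θ : ℝ) (k : ℕ) :
    Measurable fun p : ℝ × (Fin k → ℝ) => scaledPalmWeight θ p.1 p.2 := by
  refine Measurable.indicator (by fun_prop) ?_
  exact (measurable_snd (measurableSet_posOrthant k)).inter
    (measurableSet_lt (f := fun p : ℝ × (Fin k → ℝ) => ∑ l, p.2 l) (by fun_prop) measurable_fst)

theorem scaledPalmWeight_smul {k : ℕ} {v : ℝ} (hv : 0 < v) (z : Fin k → ℝ) :
    ENNReal.ofReal (v ^ k) * scaledPalmWeight θ v (v • z) = palmWeight θ z := by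
  have hsum : ∑ l, (v • z) l = v * ∑ l, z l := by simp [Finset.mul_sum]
  have hprod : ∏ l, (v • z) l = v ^ k * ∏ l, z l := by simp [Finset.prod_mul_distrib]
  have hiff : (v, v • z) ∈ {p : ℝ × (Fin k → ℝ) | (∀ l, 0 < p.2 l) ∧ ∑ l, p.2 l < p.1} ↔
      z ∈ {z : Fin k → ℝ | (∀ l, 0 < z l) ∧ ∑ l, z l < 1} := by
    simp only [mem_ofPred_eq, hsum, mul_lt_iff_lt_one_right hv]
    simp only [Pi.smul_apply, smul_eq_mul, mul_pos_iff_of_pos_left hv]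
  unfold scaledPalmWeight palmWeight
  by_cases hz : z ∈ {z : Fin k → ℝ | (∀ l, 0 < z l) ∧ ∑ l, z l < 1}
  · rw [indicator_of_mem (hiff.2 hz), indicator_of_mem hz, ← ENNReal.ofReal_mul (by positivity)]
    simp only
    rw [hsum, hprod, mul_div_cancel_left₀ _ hv.ne']
    congr 1
    have hp : ∏ l, z l ≠ 0 := (Finset.prod_pos fun l _ => hz.1 l).ne'
    field_simp
  · rw [indicator_of_notMem (fun h => hz (hiff.1 h)), indicator_of_notMem hz, mul_zero]

/-- The `k`-th order Palm formula for the Poisson-Dirichlet process with total mass `v`. -/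
theorem lintegral_factorialMeasure_smul (hθ : 0 < θ) (hX : Measurable X)
    (hPD : P.map (fun ω => (X ω : ℕ → ℝ)) = poissonDirichlet θ hθ) [SFinite P] {k : ℕ}
    {G : (Fin k → ℝ) → PointConfig → ℝ≥0∞} (hG : Measurable (Function.uncurry G))
    {v : ℝ} (hv : 0 < v) :
    ∫⁻ ω, ∫⁻ z, G z (seqConfig (v • (X ω : ℕ → ℝ))) ∂factorialMeasure k (v • (X ω : ℕ → ℝ)) ∂P =
      ∫⁻ z, scaledPalmWeight θ v z *
        ∫⁻ ω, G z (addAtoms (seqConfig ((v - ∑ l, z l) • (X ω : ℕ → ℝ))) z) ∂P := by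
  have := isProbabilityMeasure_gemMeasure hθ
  have hcomp : ∀ (σ : ℕ ≃ ℕ) (y : ℕ → ℝ) (c : ℝ),
      (c • fun n => y (σ n)) = fun n => (c • y) (σ n) := fun σ y c => rfl
  have hpm := measurableSet_posOrthant k
  let K : (Fin k → ℝ) → PointConfig → ℝ≥0∞ := fun z η => (posOrthant k).indicator (fun z => G z η) z
  have hK : Measurable (Function.uncurry K) :=
    hG.indicator (s := Prod.fst ⁻¹' posOrthant k) (measurable_fst hpm)
  have hLm : Measurable fun y : ℕ → ℝ =>
      ∑' e : Fin k ↪ ℕ, K (fun l => (v • y) (e l)) (seqConfig (v • y)) := by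
    have : Countable (Fin k ↪ ℕ) := DFunLike.coe_injective.countable
    fun_prop
  have hL : ∀ y : ℕ → ℝ, ∫⁻ z, G z (seqConfig (v • y)) ∂factorialMeasure k (v • y) =
      ∑' e : Fin k ↪ ℕ, K (fun l => (v • y) (e l)) (seqConfig (v • y)) := fun y =>
    lintegral_factorialMeasure _ (by fun_prop)
  have e1 : ∫⁻ ω, ∫⁻ z, G z (seqConfig (v • (X ω : ℕ → ℝ)))
      ∂factorialMeasure k (v • (X ω : ℕ → ℝ)) ∂P =
      ∫⁻ y, ∫⁻ z, G z (seqConfig (v • y)) ∂factorialMeasure k (v • y) ∂gemMeasure θ hθ := by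
    refine lintegral_poissonDirichlet hθ hX hPD
      (F := fun y => ∫⁻ z, G z (seqConfig (v • y)) ∂factorialMeasure k (v • y)) ?_ ?_
    · simpa only [hL] using hLm
    · intro σ y
      simp only [hcomp, seqConfig_comp_equiv, factorialMeasure_comp_equiv]
  have e2 : ∫⁻ y, ∫⁻ z, G z (seqConfig (v • y)) ∂factorialMeasure k (v • y) ∂gemMeasure θ hθ =
      ∫⁻ y, palmSum k (fun z s => K (v • z) (addAtoms (seqConfig (v • s)) (v • z))) y
        ∂gemMeasure θ hθ := by
    refine lintegral_congr_ae ?_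
    filter_upwards [ae_gemMeasure hθ] with y hy
    rw [hL, ← palmSum_addAtoms k K (y := v • y) (.of_summable (hy.2.const_smul v)), palmSum_smul]
  have hm : Measurable fun z => scaledPalmWeight θ v z *
      ∫⁻ ω, G z (addAtoms (seqConfig ((v - ∑ l, z l) • (X ω : ℕ → ℝ))) z) ∂P := by fun_prop
  rw [e1, e2, lintegral_palmSum hθ k (by fun_prop), ← lintegral_comp_smul_of_pos volume hm hv,
    Module.finrank_fin_fun, ← lintegral_const_mul _ (by fun_prop)]
  refine lintegral_congr fun z => ?_
  rw [← mul_assoc, scaledPalmWeight_smul hv]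
  -- Off the open simplex the weight vanishes. On it the indicator in `K` is one, and the mass left
  -- is `v - |v z| = v (1 - |z|)`.
  by_cases hz : (∀ l, 0 < z l) ∧ ∑ l, z l < 1
  · congr 1
    have hsum : v - ∑ l, (v • z) l = v * (1 - ∑ l, z l) := by
      simp [← Finset.mul_sum, mul_sub]
    have hvz : v • z ∈ posOrthant k := fun l => mul_pos hv (hz.1 l)
    rw [hsum]
    simp only [K, indicator_of_mem hvz, smul_smul]
    refine (lintegral_poissonDirichlet hθ hX hPD (F := fun y =>
      G (v • z) (addAtoms (seqConfig ((v * (1 - ∑ l, z l)) • y)) (v • z))) (by fun_prop) ?_).symm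
    intro σ y
    simp only [hcomp, seqConfig_comp_equiv]
  · have : palmWeight θ z = 0 := indicator_of_notMem (by exact hz) _
    rw [this, zero_mul, zero_mul]

end

/-! ### Correlation functions of lifted Poisson-Dirichlet processes -/

theorem measurable_lintegral_factorialMeasure {k : ℕ} {G : (Fin k → ℝ) → PointConfig → ℝ≥0∞}
    (hG : Measurable (Function.uncurry G)) :
    Measurable fun y : ℕ → ℝ => ∫⁻ z, G z (seqConfig y) ∂factorialMeasure k y := by
  have : Countable (Fin k ↪ ℕ) := DFunLike.coe_injective.countable
  have hK : Measurable fun p : (Fin k → ℝ) × PointConfig =>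
      (posOrthant k).indicator (fun z => G z p.2) p.1 :=
    hG.indicator (s := Prod.fst ⁻¹' posOrthant k) (measurable_fst (measurableSet_posOrthant k))
  have h : ∀ y : ℕ → ℝ, ∫⁻ z, G z (seqConfig y) ∂factorialMeasure k y =
      ∑' e : Fin k ↪ ℕ, (posOrthant k).indicator (fun z => G z (seqConfig y)) fun l => y (e l) :=
    fun y => lintegral_factorialMeasure _ (by fun_prop)
  simp only [h]
  exact Measurable.tsum fun e => hK.comp (by fun_prop :
    Measurable fun y : ℕ → ℝ => ((fun l => y (e l), seqConfig y) : (Fin k → ℝ) × PointConfig))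

theorem lintegral_correlationMeasure {Ω : Type*} [MeasurableSpace Ω] {P : Measure Ω}
    {Z : Ω → RankedCone}
    (hZ : Measurable fun ω => (Z ω : ℕ → ℝ)) {k : ℕ} {f : (Fin k → ℝ) → ℝ≥0∞} (hf : Measurable f) :
    ∫⁻ z, f z ∂correlationMeasure P Z k = ∫⁻ ω, ∫⁻ z, f z ∂factorialMeasure k (Z ω) ∂P :=
  Measure.lintegral_bind ((measurable_factorialMeasure k).comp hZ).aemeasurable hf.aemeasurable

section

variable {Ω : Type*} [MeasurableSpace Ω] {P : Measure Ω} [IsProbabilityMeasure P] {θ : ℝ}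
  {X : Ω → RankedSimplex} {V : Ω → Ioi (0 : ℝ)} {ρ : Measure ℝ}

theorem lintegral_of_indepFun (hX : Measurable X) (hV : Measurable V) (hindep : IndepFun V X P)
    (hρ : ρ = P.map (fun ω => (V ω : ℝ))) {H : ℝ → (ℕ → ℝ) → ℝ≥0∞}
    (hH : Measurable (Function.uncurry H)) :
    ∫⁻ ω, H (V ω) (X ω : ℕ → ℝ) ∂P = ∫⁻ v, ∫⁻ ω, H v (X ω : ℕ → ℝ) ∂P ∂ρ := by
  have h := (indepFun_iff_map_prod_eq_prod_map_map hV.aemeasurable hX.aemeasurable).1 hindep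
  have := Measure.isProbabilityMeasure_map (μ := P) hX.aemeasurable
  have hm : Measurable fun p : Ioi (0 : ℝ) × RankedSimplex => H p.1 (p.2 : ℕ → ℝ) :=
    hH.comp (by fun_prop : Measurable fun p : Ioi (0 : ℝ) × RankedSimplex =>
      ((p.1 : ℝ), (p.2 : ℕ → ℝ)))
  calc ∫⁻ ω, H (V ω) (X ω : ℕ → ℝ) ∂P
      = ∫⁻ p, H p.1 (p.2 : ℕ → ℝ) ∂P.map (fun ω => (V ω, X ω)) :=
        (lintegral_map hm (hV.prodMk hX)).symm
    _ = ∫⁻ v, ∫⁻ x, H v (x : ℕ → ℝ) ∂P.map X ∂P.map V := by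
        rw [h, lintegral_prod _ hm.aemeasurable]
    _ = ∫⁻ v, ∫⁻ ω, H v (X ω : ℕ → ℝ) ∂P ∂P.map V := by
        refine lintegral_congr fun v => lintegral_map ?_ hX
        exact hm.comp (measurable_const.prodMk measurable_id)
    _ = ∫⁻ v, ∫⁻ ω, H v (X ω : ℕ → ℝ) ∂P ∂ρ := by
        rw [hρ, lintegral_map (g := V) (by fun_prop) hV,
          lintegral_map (g := fun ω => (V ω : ℝ)) (by fun_prop) (by fun_prop)]

theorem coe_liftSeq (v : Ioi (0 : ℝ)) (x : RankedSimplex) :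
    (liftSeq v x : ℕ → ℝ) = (v : ℝ) • (x : ℕ → ℝ) := rfl

/-- The `k`-th order Palm formula for the Poisson-Dirichlet process with random total mass. -/
theorem lintegral_factorialMeasure_liftSeq (hθ : 0 < θ) (hX : Measurable X) (hV : Measurable V)
    (hPD : P.map (fun ω => (X ω : ℕ → ℝ)) = poissonDirichlet θ hθ) (hindep : IndepFun V X P)
    (hρ : ρ = P.map (fun ω => (V ω : ℝ))) {k : ℕ} {G : (Fin k → ℝ) → PointConfig → ℝ≥0∞}
    (hG : Measurable (Function.uncurry G)) :
    ∫⁻ ω, ∫⁻ z, G z (configOfSeq (liftSeq (V ω) (X ω))) ∂factorialMeasure k (liftSeq (V ω) (X ω))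
      ∂P = ∫⁻ z, ∫⁻ v, scaledPalmWeight θ v z *
        ∫⁻ ω, G z (addAtoms (seqConfig ((v - ∑ l, z l) • (X ω : ℕ → ℝ))) z) ∂P ∂ρ := by
  have : IsProbabilityMeasure ρ := by
    rw [hρ]; exact Measure.isProbabilityMeasure_map (by fun_prop)
  simp only [configOfSeq_eq, coe_liftSeq]
  rw [lintegral_of_indepFun hX hV hindep hρ (H := fun v x =>
    ∫⁻ z, G z (seqConfig (v • x)) ∂factorialMeasure k (v • x)), ← lintegral_lintegral_swap
      (f := fun v z => scaledPalmWeight θ v z *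
        ∫⁻ ω, G z (addAtoms (seqConfig ((v - ∑ l, z l) • (X ω : ℕ → ℝ))) z) ∂P)]
  · refine lintegral_congr_ae ?_
    have hpos : ∀ᵐ v ∂ρ, 0 < v := by
      rw [hρ, ae_map_iff (by fun_prop) measurableSet_Ioi]
      exact ae_of_all _ fun ω => (V ω).2
    filter_upwards [hpos] with v hv
    exact lintegral_factorialMeasure_smul hθ hX hPD hG hv
  · exact Measurable.aemeasurable (by fun_prop)
  · exact (measurable_lintegral_factorialMeasure hG).comp
      (by fun_prop : Measurable fun p : ℝ × (ℕ → ℝ) => p.1 • p.2)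

end

section

variable {θ : ℝ} {ρ : Measure ℝ} {k : ℕ}

theorem scaledPalmWeight_eq (hθ : 0 < θ) {z : Fin k → ℝ} (hz : z ∈ posOrthant k) (v : ℝ) :
    scaledPalmWeight θ v z = ENNReal.ofReal (θ ^ k / ∏ l, z l) *
      (Ioi (∑ l, z l)).indicator
        (fun v => ENNReal.ofReal ((1 - (∑ l, z l) / v) ^ (θ - 1))) v := by
  have hp : 0 < ∏ l, z l := Finset.prod_pos fun l _ => hz l
  unfold scaledPalmWeight
  by_cases hv : ∑ l, z l < v
  · rw [indicator_of_mem (show v ∈ Ioi _ from hv), indicator_of_mem (by exact ⟨hz, hv⟩),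
      ← ENNReal.ofReal_mul (by positivity)]
  · rw [indicator_of_notMem (show v ∉ Ioi _ from hv), indicator_of_notMem (by exact fun h => hv h.2),
      mul_zero]

theorem scaledPalmWeight_eq_zero {z : Fin k → ℝ} (hz : z ∉ posOrthant k) (v : ℝ) :
    scaledPalmWeight θ v z = 0 :=
  indicator_of_notMem (by exact fun h => hz h.1) _

theorem lintegral_scaledPalmWeight_mul (hθ : 0 < θ) {z : Fin k → ℝ} (hz : z ∈ posOrthant k)
    {f : ℝ → ℝ≥0∞} (hf : Measurable f) :
    ∫⁻ v, scaledPalmWeight θ v z * f v ∂ρ = ENNReal.ofReal (θ ^ k / ∏ l, z l) *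
      ∫⁻ v in Ioi (∑ l, z l), ENNReal.ofReal ((1 - (∑ l, z l) / v) ^ (θ - 1)) * f v ∂ρ := by
  rw [← lintegral_const_mul _ (by fun_prop), ← lintegral_indicator measurableSet_Ioi]
  refine lintegral_congr fun v => ?_
  rw [scaledPalmWeight_eq hθ hz]
  by_cases hv : v ∈ Ioi (∑ l, z l)
  · rw [indicator_of_mem hv, indicator_of_mem hv, mul_assoc]
  · rw [indicator_of_notMem hv, indicator_of_notMem hv, mul_zero, zero_mul]

theorem lintegral_scaledPalmWeight (hθ : 0 < θ) {z : Fin k → ℝ} (hz : z ∈ posOrthant k) :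
    ∫⁻ v, scaledPalmWeight θ v z ∂ρ = liftedCorrelation θ ρ z := by
  have h := lintegral_scaledPalmWeight_mul (ρ := ρ) hθ hz (f := fun _ => 1) measurable_const
  simp only [mul_one] at h
  exact h

theorem measurable_liftedCorrelation [SFinite ρ] :
    Measurable fun z : Fin k → ℝ => liftedCorrelation θ ρ z := by
  have h : ∀ z : Fin k → ℝ, palmMass θ ρ z = ∫⁻ v, {p : (Fin k → ℝ) × ℝ | ∑ l, p.1 l < p.2}.indicator
      (fun p => ENNReal.ofReal ((1 - (∑ l, p.1 l) / p.2) ^ (θ - 1))) (z, v) ∂ρ := fun z => by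
    rw [palmMass, ← lintegral_indicator measurableSet_Ioi]
    rfl
  have hm : Measurable ({p : (Fin k → ℝ) × ℝ | ∑ l, p.1 l < p.2}.indicator
      (fun p => ENNReal.ofReal ((1 - (∑ l, p.1 l) / p.2) ^ (θ - 1)))) :=
    Measurable.indicator (by fun_prop) (measurableSet_lt
      (f := fun p : (Fin k → ℝ) × ℝ => ∑ l, p.1 l) (by fun_prop) measurable_snd)
  simp only [liftedCorrelation, h]
  fun_prop

/-- The prefactor is positive and the integrand is strictly positive on `(|z|, ∞)`, so only the mass
of that half-line matters. -/
theorem liftedCorrelation_eq_zero_iff (hθ : 0 < θ) {z : Fin k → ℝ} (hz : z ∈ posOrthant k) :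
    liftedCorrelation θ ρ z = 0 ↔ ρ (Ioi (∑ l, z l)) = 0 := by
  have hp : 0 < ∏ l, z l := Finset.prod_pos fun l _ => hz l
  have hs : 0 ≤ ∑ l, z l := Finset.sum_nonneg fun l _ => (hz l).le
  rw [liftedCorrelation, mul_eq_zero, or_iff_right (ENNReal.ofReal_pos.2 (by positivity)).ne',
    palmMass, setLIntegral_eq_zero_iff measurableSet_Ioi (by fun_prop), ← compl_mem_ae_iff]
  refine ⟨fun h => ?_, fun h => ?_⟩
  · filter_upwards [h] with v hv hvs
    have hv0 : 0 < v := hs.trans_lt hvs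
    exact (ENNReal.ofReal_pos.2 (Real.rpow_pos_of_pos
      (sub_pos.2 ((div_lt_one hv0).2 hvs)) _)).ne' (hv hvs)
  · filter_upwards [h] with v hv hvs using absurd hvs hv

end

theorem tsum_embedding_prod_le (k : ℕ) (y : ℕ → ℝ) :
    ∑' e : Fin k ↪ ℕ, ∏ l, ENNReal.ofReal (y (e l)) ≤ (∑' i, ENNReal.ofReal (y i)) ^ k := by
  induction k generalizing y with
  | zero =>
    rw [tsum_eq_single (Function.Embedding.ofIsEmpty) fun e he => absurd (Subsingleton.elim _ _) he]
    simp
  | succ k ih =>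
    rw [tsum_embedding_succ fun z => ∏ l, ENNReal.ofReal (z l), pow_succ', ← ENNReal.tsum_mul_right]
    refine ENNReal.tsum_le_tsum fun i => ?_
    simp only [Fin.prod_univ_succ, Fin.cons_zero, Fin.cons_succ]
    rw [ENNReal.tsum_mul_left]
    gcongr
    refine (ih (seqErase i y)).trans ?_
    rw [tsum_seqErase ENNReal.ofReal i y]
    gcongr
    exact le_add_self

/-! ### Finiteness and identification of the correlation functions -/

section

variable {Ω : Type*} [MeasurableSpace Ω] {P : Measure Ω} [IsProbabilityMeasure P] {θ : ℝ}
  {X : Ω → RankedSimplex} {V : Ω → Ioi (0 : ℝ)} {ρ : Measure ℝ}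

/-- By the Palm formula the left side is the mean of the sum of `z₁ ⋯ z_k` over tuples of distinct
points, and dropping distinctness bounds that sum by the `k`-th power of the total mass `v`. -/
theorem lintegral_scaledPalmWeight_prod_le (hθ : 0 < θ) (hX : Measurable X)
    (hPD : P.map (fun ω => (X ω : ℕ → ℝ)) = poissonDirichlet θ hθ) (k : ℕ) {v : ℝ} (hv : 0 < v) :
    ∫⁻ z : Fin k → ℝ, scaledPalmWeight θ v z * ∏ l, ENNReal.ofReal (z l) ≤
      ENNReal.ofReal (v ^ k) := by
  have h := lintegral_factorialMeasure_smul hθ hX hPD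
    (G := fun z _ => ∏ l : Fin k, ENNReal.ofReal (z l)) (by fun_prop) hv
  simp only [lintegral_const, measure_univ, mul_one] at h
  rw [← h]
  have hle : ∀ ω, ∫⁻ z, ∏ l : Fin k, ENNReal.ofReal (z l)
      ∂factorialMeasure k (v • (X ω : ℕ → ℝ)) ≤ ENNReal.ofReal (v ^ k) := by
    intro ω
    rw [lintegral_factorialMeasure _ (by fun_prop)]
    calc ∑' e : Fin k ↪ ℕ, (posOrthant k).indicator (fun z => ∏ l, ENNReal.ofReal (z l))
          (fun l => (v • (X ω : ℕ → ℝ)) (e l))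
        ≤ ∑' e : Fin k ↪ ℕ, ∏ l, ENNReal.ofReal ((v • (X ω : ℕ → ℝ)) (e l)) :=
          ENNReal.tsum_le_tsum fun e => indicator_le_self (posOrthant k) _ _
      _ ≤ (∑' i, ENNReal.ofReal ((v • (X ω : ℕ → ℝ)) i)) ^ k := tsum_embedding_prod_le k _
      _ = ENNReal.ofReal (v ^ k) := by
          obtain ⟨-, hnonneg, hsum⟩ := (X ω).2
          have hs := hsum.mul_left v
          rw [← ENNReal.ofReal_tsum_of_nonneg (f := v • (X ω : ℕ → ℝ))
            (fun i => mul_nonneg hv.le (hnonneg i)) hs.summable,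
            ENNReal.ofReal_pow hv.le]
          congr 2
          exact hs.tsum_eq.trans (mul_one v)
  calc _ ≤ ∫⁻ _, ENNReal.ofReal (v ^ k) ∂P := lintegral_mono hle
    _ = _ := by simp

/-- For `θ < 1` the integrand blows up as `v` decreases to `|z|`. The moment bound controls the part
`v ≤ M` for almost every `z`; the part `v > M > 2 |z|` is bounded outright. -/
theorem ae_liftedCorrelation_lt_top (hθ : 0 < θ) (hX : Measurable X)
    (hPD : P.map (fun ω => (X ω : ℕ → ℝ)) = poissonDirichlet θ hθ) [IsProbabilityMeasure ρ]
    (hpos : ∀ᵐ v ∂ρ, 0 < v) (k : ℕ) :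
    ∀ᵐ z : Fin k → ℝ, z ∈ posOrthant k → liftedCorrelation θ ρ z < ∞ := by
  have h1 : ∀ M : ℕ, ∀ᵐ z : Fin k → ℝ,
      ∫⁻ v in Iic (M : ℝ), scaledPalmWeight θ v z * ∏ l, ENNReal.ofReal (z l) ∂ρ < ∞ := by
    intro M
    refine ae_lt_top (by fun_prop) (ne_of_lt ?_)
    rw [lintegral_lintegral_swap (by fun_prop)]
    calc _ ≤ ∫⁻ _ in Iic (M : ℝ), ENNReal.ofReal ((M : ℝ) ^ k) ∂ρ := by
          refine lintegral_mono_ae ?_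
          filter_upwards [ae_restrict_of_ae hpos, ae_restrict_mem measurableSet_Iic] with v hv hvM
          refine (lintegral_scaledPalmWeight_prod_le hθ hX hPD k hv).trans ?_
          exact ENNReal.ofReal_le_ofReal (pow_le_pow_left₀ hv.le hvM k)
      _ < ∞ := by
          rw [lintegral_const]
          exact ENNReal.mul_lt_top ENNReal.ofReal_lt_top (measure_lt_top _ _)
  rw [← ae_all_iff] at h1
  filter_upwards [h1] with z hz hzp
  have hp : 0 < ∏ l, z l := Finset.prod_pos fun l _ => hzp l
  have hs : 0 ≤ ∑ l, z l := Finset.sum_nonneg fun l _ => (hzp l).le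
  -- The cut-off depends on `z`, hence the preceding almost sure statement for all `M` at once.
  obtain ⟨M, hM⟩ := exists_nat_gt (2 * ∑ l, z l)
  rw [← lintegral_scaledPalmWeight hθ hzp, ← lintegral_add_compl _ (measurableSet_Iic (a := (M : ℝ)))]
  refine ENNReal.add_lt_top.2 ⟨?_, ?_⟩
  · have h2 := hz M
    rw [lintegral_mul_const _ (by fun_prop)] at h2
    refine ENNReal.lt_top_of_mul_ne_top_left h2.ne ?_
    rw [← ENNReal.ofReal_prod_of_nonneg fun l _ => (hzp l).le]
    exact (ENNReal.ofReal_pos.2 hp).ne'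
  · calc _ ≤ ∫⁻ _ in (Iic (M : ℝ))ᶜ, ENNReal.ofReal (θ ^ k / ∏ l, z l) * ENNReal.ofReal 2 ∂ρ := by
          refine lintegral_mono_ae ?_
          filter_upwards [ae_restrict_mem measurableSet_Iic.compl] with v hv
          rw [scaledPalmWeight_eq hθ hzp]
          gcongr
          refine (indicator_le_self _ _ _).trans ?_
          refine ENNReal.ofReal_le_ofReal ?_
          have hMv : (M : ℝ) < v := not_le.1 hv
          have hv0 : 0 < v := by linarith
          have hd : (∑ l, z l) / v ≤ 1 / 2 := by rw [div_le_iff₀ hv0]; linarith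
          have hd0 : 0 ≤ (∑ l, z l) / v := by positivity
          have ht : 0 < 1 - (∑ l, z l) / v := by linarith
          -- With `t = 1 - |z| / v ≥ 1 / 2`, the bound `t^(θ - 1) = t^θ / t ≤ 1 / t ≤ 2` covers all
          -- `θ > 0`.
          rw [Real.rpow_sub_one ht.ne', div_le_iff₀ ht]
          have := Real.rpow_le_one ht.le (by linarith) hθ.le
          linarith
      _ < ∞ := by
          rw [lintegral_const]
          exact ENNReal.mul_lt_top (ENNReal.mul_lt_top ENNReal.ofReal_lt_top ENNReal.ofReal_lt_top)
            (measure_lt_top _ _)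

theorem correlationMeasure_liftSeq (hθ : 0 < θ) (hX : Measurable X) (hV : Measurable V)
    (hPD : P.map (fun ω => (X ω : ℕ → ℝ)) = poissonDirichlet θ hθ) (hindep : IndepFun V X P)
    (hρ : ρ = P.map (fun ω => (V ω : ℝ))) (k : ℕ) :
    correlationMeasure P (fun ω => liftSeq (V ω) (X ω)) k =
      (volume.restrict (posOrthant k)).withDensity (liftedCorrelation θ ρ) := by
  have : IsProbabilityMeasure ρ := by
    rw [hρ]; exact Measure.isProbabilityMeasure_map (by fun_prop)
  refine Measure.ext_of_lintegral _ fun f hf => ?_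
  have hZ : Measurable fun ω => (liftSeq (V ω) (X ω) : ℕ → ℝ) := by
    simp only [coe_liftSeq]; fun_prop
  rw [lintegral_correlationMeasure hZ hf, lintegral_factorialMeasure_liftSeq hθ hX hV hPD hindep hρ
    (G := fun z _ => f z) (by fun_prop), lintegral_withDensity_eq_lintegral_mul _
    measurable_liftedCorrelation hf, ← lintegral_indicator (measurableSet_posOrthant k)]
  refine lintegral_congr fun z => ?_
  simp only [lintegral_const, measure_univ, mul_one]
  by_cases hz : z ∈ posOrthant k
  · rw [indicator_of_mem hz, Pi.mul_apply, lintegral_mul_const _ (by fun_prop),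
      lintegral_scaledPalmWeight hθ hz]
  · simp [indicator_of_notMem hz, scaledPalmWeight_eq_zero hz]

end

/-! ### Laplace functionals determine laws of point configurations -/

/-- Index set of the intervals `(p, q]` with rational end points and `p > 0`. -/
abbrev RatInterval : Type := {p : ℚ // 0 < p} × ℚ

/-- The interval `(p, q]`. -/
def RatInterval.toSet (j : RatInterval) : Set ℝ := Ioc (j.1.1 : ℝ) (j.2 : ℝ)

theorem RatInterval.measurableSet (j : RatInterval) : MeasurableSet j.toSet := measurableSet_Ioc

theorem PointConfig.measure_Ioc_ne_top (η : PointConfig) {a : ℝ} (ha : 0 < a) (b : ℝ) :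
    η.1 (Ioc a b) ≠ ∞ := by
  obtain ⟨n, hn⟩ := η.2.2 a b ha _ measurableSet_Ioc Ioc_subset_Icc_self
  rw [hn]
  exact ENNReal.natCast_ne_top n

theorem PointConfig.measure_ratInterval_ne_top (η : PointConfig) (j : RatInterval) :
    η.1 j.toSet ≠ ∞ :=
  η.measure_Ioc_ne_top (Rat.cast_pos.2 j.1.2) _

/-- The number of points in a rational interval. -/
noncomputable def intervalCount (η : PointConfig) (j : RatInterval) : ℝ := (η.1 j.toSet).toReal

@[fun_prop]
theorem measurable_intervalCount (j : RatInterval) : Measurable fun η => intervalCount η j :=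
  ((Measure.measurable_coe j.measurableSet).comp measurable_subtype_coe).ennreal_toReal

theorem intervalCount_nonneg (η : PointConfig) (j : RatInterval) : 0 ≤ intervalCount η j :=
  ENNReal.toReal_nonneg

/-- `∑ⱼ nⱼ η(Iⱼ)`. -/
noncomputable def weightedCount (n : RatInterval →₀ ℕ) (η : PointConfig) : ℝ :=
  n.sum fun j c => c * intervalCount η j

@[fun_prop]
theorem measurable_weightedCount (n : RatInterval →₀ ℕ) : Measurable (weightedCount n) := by
  unfold weightedCount Finsupp.sum
  fun_prop

/-- The coordinates `exp (-η(Iⱼ))` of a configuration. -/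
noncomputable def expCoord (η : PointConfig) (j : RatInterval) : unitInterval :=
  ⟨Real.exp (-intervalCount η j), (Real.exp_pos _).le,
    Real.exp_le_one_iff.2 (neg_nonpos.2 (intervalCount_nonneg η j))⟩

theorem measurable_expCoord : Measurable expCoord :=
  measurable_pi_lambda _ fun j => Measurable.subtype_mk (by fun_prop)

/-- Counts on rational intervals are recovered as `-log` of the coordinates. They determine the
restriction of `η` to each `(1 / (m + 1), m]` by a π-system argument, and these windows exhaust `(0,
∞)`, which carries `η`. -/
theorem measurableSpace_le_comap_expCoord :
    (inferInstance : MeasurableSpace PointConfig) ≤ MeasurableSpace.comap expCoord inferInstance := by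
  have hcount : ∀ j : RatInterval,
      Measurable[MeasurableSpace.comap expCoord inferInstance] fun η : PointConfig => η.1 j.toSet := by
    intro j
    have : (fun η : PointConfig => η.1 j.toSet) =
        (fun x : RatInterval → unitInterval => ENNReal.ofReal (-Real.log (x j))) ∘ expCoord := by
      funext η
      simp only [Function.comp_apply, expCoord, Real.log_exp, neg_neg, intervalCount]
      exact (ENNReal.ofReal_toReal (η.measure_ratInterval_ne_top j)).symm
    rw [this]
    exact Measurable.comp (by fun_prop) (comap_measurable expCoord)
  have hval : Measurable[MeasurableSpace.comap expCoord inferInstance]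
      fun η : PointConfig => η.1 := by
    let a : ℕ → ℚ := fun m => 1 / ((m : ℚ) + 1)
    have ha : ∀ m, 0 < a m := fun m => by positivity
    have hres : ∀ m : ℕ, Measurable[MeasurableSpace.comap expCoord inferInstance]
        fun η : PointConfig => η.1.restrict (Ioc (a m : ℝ) ((m : ℚ) : ℝ)) := by
      intro m
      have hfin : ∀ η : PointConfig, IsFiniteMeasure (η.1.restrict (Ioc (a m : ℝ) ((m : ℚ) : ℝ))) :=
        fun η => ⟨by
          rw [Measure.restrict_apply_univ]
          exact (η.measure_Ioc_ne_top (Rat.cast_pos.2 (ha m)) _).lt_top⟩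
      have hgen : (inferInstance : MeasurableSpace ℝ) =
          MeasurableSpace.generateFrom (⋃ q : ℚ, {Iic (q : ℝ)}) := by
        rw [← Real.borel_eq_generateFrom_Iic_rat]
        exact BorelSpace.measurable_eq
      refine @Measurable.measure_of_isPiSystem PointConfig ℝ (MeasurableSpace.comap expCoord inferInstance)
        _ _ hfin _ hgen Real.isPiSystem_Iic_rat ?_ ?_
      · intro s hs
        obtain ⟨q, rfl⟩ := by simpa using hs
        have : ∀ η : PointConfig, η.1.restrict (Ioc (a m : ℝ) ((m : ℚ) : ℝ)) (Iic (q : ℝ)) =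
            η.1 (RatInterval.toSet (⟨a m, ha m⟩, min (m : ℚ) q)) := fun η => by
          rw [Measure.restrict_apply measurableSet_Iic, inter_comm, Ioc_inter_Iic, RatInterval.toSet,
            Rat.cast_min]
        simp only [this]
        exact hcount _
      · have : ∀ η : PointConfig, η.1.restrict (Ioc (a m : ℝ) ((m : ℚ) : ℝ)) univ =
            η.1 (RatInterval.toSet (⟨a m, ha m⟩, (m : ℚ))) := fun η => by
          rw [Measure.restrict_apply_univ, RatInterval.toSet]
        simp only [this]
        exact hcount _
    refine @Measure.measurable_of_measurable_coe _ _ _ (MeasurableSpace.comap expCoord inferInstance)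
      _ fun s hs => ?_
    have hsup : ∀ η : PointConfig, η.1 s =
        ⨆ m : ℕ, η.1.restrict (Ioc (a m : ℝ) ((m : ℚ) : ℝ)) s := by
      intro η
      have hmono : Monotone fun m : ℕ => s ∩ Ioc (a m : ℝ) ((m : ℚ) : ℝ) := by
        intro m m' h
        have h' : (m : ℝ) ≤ m' := by exact_mod_cast h
        refine inter_subset_inter_right _ (Ioc_subset_Ioc ?_ (by exact_mod_cast h))
        simp only [a]
        push_cast
        gcongr
      have hU : ⋃ m : ℕ, s ∩ Ioc (a m : ℝ) ((m : ℚ) : ℝ) = s ∩ Ioi 0 := by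
        rw [← inter_iUnion]
        congr 1
        ext x
        simp only [mem_iUnion, mem_Ioc, mem_Ioi]
        constructor
        · rintro ⟨m, h, -⟩
          exact (Rat.cast_pos.2 (ha m)).trans h
        · intro hx
          obtain ⟨m, hm⟩ := exists_nat_one_div_lt hx
          obtain ⟨m', hm'⟩ := exists_nat_ge x
          refine ⟨max m m', ?_, ?_⟩
          · refine lt_of_le_of_lt ?_ hm
            simp only [a]
            push_cast
            gcongr
            exact le_max_left _ _
          · refine hm'.trans ?_
            exact_mod_cast le_max_right _ _
      simp only [Measure.restrict_apply hs]
      rw [← hmono.measure_iUnion, hU, measure_inter_conull]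
      rw [compl_Ioi]
      exact η.2.1
    simp only [hsup]
    exact Measurable.iSup fun m => (Measure.measurable_coe hs).comp (hres m)
  rw [measurable_iff_comap_le] at hval
  exact hval

/-- Two finite measures on `[0, 1]^ι`, with `ι` countable, that have the same moments are equal. -/
theorem ext_of_integral_monomials {ι : Type*} [Countable ι] {μ ν : Measure (ι → unitInterval)}
    [IsFiniteMeasure μ] [IsFiniteMeasure ν]
    (h : ∀ n : ι →₀ ℕ, ∫ x, n.prod (fun j c => (x j : ℝ) ^ c) ∂μ =
      ∫ x, n.prod (fun j c => (x j : ℝ) ^ c) ∂ν) : μ = ν := by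
  let coord : ι → BoundedContinuousFunction (ι → unitInterval) ℝ := fun j =>
    BoundedContinuousFunction.mkOfCompact ⟨fun x => (x j : ℝ), by fun_prop⟩
  let A : StarSubalgebra ℝ (BoundedContinuousFunction (ι → unitInterval) ℝ) :=
    { Algebra.adjoin ℝ (range coord) with
      star_mem' := fun {f} hf => by
        have : star f = f := by ext x; simp
        rw [this]; exact hf }
  refine ext_of_forall_mem_subalgebra_integral_eq_of_polish (𝕜 := ℝ) (A := A) ?_ ?_
  · intro x y hxy
    obtain ⟨j, hj⟩ := Function.ne_iff.1 hxy
    refine ⟨fun x => (x j : ℝ), ⟨⟨fun x => (x j : ℝ), by fun_prop⟩, ?_, rfl⟩,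
      fun h => hj (Subtype.ext h)⟩
    exact ⟨coord j, Algebra.subset_adjoin ⟨j, rfl⟩, rfl⟩
  · intro g hg
    -- The coordinates separate points, so their algebra determines finite measures; that algebra is
    -- spanned by monomials, and integration is linear.
    have hg' : g ∈ Submodule.span ℝ (Submonoid.closure (range coord) :
        Set (BoundedContinuousFunction (ι → unitInterval) ℝ)) := by
      rw [← Algebra.adjoin_eq_span]
      exact hg
    clear hg
    have hmon : ∀ f ∈ Submonoid.closure (range coord), ∃ n : ι →₀ ℕ,
        ∀ x, f x = n.prod (fun j c => (x j : ℝ) ^ c) := by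
      classical
      intro f hf
      induction hf using Submonoid.closure_induction with
      | mem f hf =>
        obtain ⟨j, rfl⟩ := hf
        exact ⟨Finsupp.single j 1, fun x => by simp [coord]⟩
      | one => exact ⟨0, fun x => by simp⟩
      | mul f g _ _ hf hg =>
        obtain ⟨n, hn⟩ := hf
        obtain ⟨m, hm⟩ := hg
        refine ⟨n + m, fun x => ?_⟩
        rw [Finsupp.prod_add_index' (by simp) (by intros; rw [pow_add]), ← hn, ← hm]
        rfl
    induction hg' using Submodule.span_induction with
    | mem f hf =>
      obtain ⟨n, hn⟩ := hmon f hf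
      simp only [hn]
      exact h n
    | zero => simp
    | add f g hf hg ihf ihg =>
      simp only [BoundedContinuousFunction.coe_add, Pi.add_apply]
      rw [integral_add (f.integrable μ) (g.integrable μ),
        integral_add (f.integrable ν) (g.integrable ν), ihf, ihg]
    | smul c f hf ih =>
      simp only [BoundedContinuousFunction.coe_smul]
      rw [integral_smul, integral_smul, ih]

theorem prod_expCoord (n : RatInterval →₀ ℕ) (η : PointConfig) :
    n.prod (fun j c => (expCoord η j : ℝ) ^ c) = Real.exp (-weightedCount n η) := by
  rw [weightedCount, Finsupp.sum, ← Finset.sum_neg_distrib, Real.exp_sum]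
  refine Finset.prod_congr rfl fun j _ => ?_
  change Real.exp (-intervalCount η j) ^ n j = _
  rw [← Real.exp_nat_mul]
  congr 1
  ring

/-- With natural coefficients, `exp (-∑ nⱼ η(Iⱼ))` is a monomial in the coordinates `exp (-η(Iⱼ))`,
so the hypothesis is equality of all moments. The index set is countable, which allows use almost
everywhere. -/
theorem PointConfig.measure_ext {Q₁ Q₂ : Measure PointConfig} [IsFiniteMeasure Q₁]
    [IsFiniteMeasure Q₂]
    (h : ∀ n : RatInterval →₀ ℕ, ∫⁻ η, ENNReal.ofReal (Real.exp (-weightedCount n η)) ∂Q₁ =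
      ∫⁻ η, ENNReal.ofReal (Real.exp (-weightedCount n η)) ∂Q₂) : Q₁ = Q₂ := by
  have hmap : Q₁.map expCoord = Q₂.map expCoord := by
    refine ext_of_integral_monomials fun n => ?_
    have hm : Measurable fun x : RatInterval → unitInterval => n.prod (fun j c => (x j : ℝ) ^ c) := by
      unfold Finsupp.prod
      fun_prop
    rw [integral_map measurable_expCoord.aemeasurable hm.aestronglyMeasurable,
      integral_map measurable_expCoord.aemeasurable hm.aestronglyMeasurable]
    simp only [prod_expCoord]
    rw [integral_eq_lintegral_of_nonneg_ae (ae_of_all _ fun _ => (Real.exp_pos _).le)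
      (by fun_prop), integral_eq_lintegral_of_nonneg_ae (ae_of_all _ fun _ => (Real.exp_pos _).le)
      (by fun_prop), h n]
  ext B hB
  obtain ⟨B', hB', rfl⟩ := measurableSpace_le_comap_expCoord B hB
  rw [← Measure.map_apply measurable_expCoord hB', hmap, Measure.map_apply measurable_expCoord hB']

/-! ### Multiplicative functionals of configurations -/

/-- The Bochner integral is zero where `g` is not integrable, so the formula by positive and
negative parts is cut off on a measurable set of measures. -/
theorem measurable_integral_measure {α : Type*} [MeasurableSpace α] {g : α → ℝ}
    (hg : Measurable g) : Measurable fun μ : Measure α => ∫ x, g x ∂μ := by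
  classical
  have h : (fun μ : Measure α => ∫ x, g x ∂μ) = fun μ => if ∫⁻ x, ‖g x‖ₑ ∂μ < ∞ then
      (∫⁻ x, ENNReal.ofReal (g x) ∂μ).toReal - (∫⁻ x, ENNReal.ofReal (-g x) ∂μ).toReal else 0 := by
    funext μ
    split_ifs with hμ
    · exact integral_eq_lintegral_pos_part_sub_lintegral_neg_part ⟨hg.aestronglyMeasurable, hμ⟩
    · exact integral_undef fun hi => hμ hi.2
  rw [h]
  refine Measurable.ite ?_ ?_ measurable_const
  · exact measurableSet_lt (Measure.measurable_lintegral hg.enorm) measurable_const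
  · exact (Measure.measurable_lintegral hg.ennreal_ofReal).ennreal_toReal.sub
      (Measure.measurable_lintegral hg.neg.ennreal_ofReal).ennreal_toReal

theorem measurable_configProd {φ : ℝ → ℝ} (hφ : Measurable φ) : Measurable (configProd φ) :=
  Real.measurable_exp.comp ((measurable_integral_measure (Real.measurable_log.comp hφ)).comp
    measurable_subtype_coe)

/-- Only the finitely many terms in `[a, b]` contribute, and `‖φ - 1‖_∞ < 1` keeps `φ` positive, so
`exp (log φ) = φ` there. -/
theorem configProd_seqConfig {φ : ℝ → ℝ} (hφ : IsTestFunction φ) {y : ℕ → ℝ}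
    (hy : TermsLocallyFinite y) : configProd φ (seqConfig y) = seqProd φ y := by
  obtain ⟨hm, -, ⟨a, b, ha, hout⟩, c, hc, hb⟩ := hφ
  have hpos : ∀ x, 0 < x → 0 < φ x := fun x hx => by
    have := (abs_le.1 (hb x hx)).1
    linarith
  have hfin : {i | y i ∈ Icc a b}.Finite := (hy a ha).subset fun i hi => hi.1
  have hres : (seqConfig y).1.restrict (Icc a b) = ∑ i ∈ hfin.toFinset, Measure.dirac (y i) := by
    rw [seqConfig_val hy, Measure.restrict_restrict measurableSet_Icc,
      inter_eq_left.2 (show Icc a b ⊆ Ioi 0 from fun x hx => ha.trans_le hx.1)]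
    ext s hs
    rw [Measure.restrict_apply hs, Measure.sum_apply _ (hs.inter measurableSet_Icc),
      Measure.finsetSum_apply, tsum_eq_sum (s := hfin.toFinset)]
    · refine Finset.sum_congr rfl fun i hi => ?_
      have hi' : y i ∈ Icc a b := by simpa using hi
      rw [Measure.dirac_apply' _ hs, Measure.dirac_apply' _ (hs.inter measurableSet_Icc)]
      by_cases h : y i ∈ s <;> simp [indicator, h, hi'.1, hi'.2]
    · intro i hi
      rw [Measure.dirac_apply' _ (hs.inter measurableSet_Icc)]
      exact indicator_of_notMem (fun h => hi (by simpa using h.2)) _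
  have hint : ∫ x, Real.log (φ x) ∂(seqConfig y).1 = ∑ i ∈ hfin.toFinset, Real.log (φ (y i)) := by
    rw [← setIntegral_eq_integral_of_ae_compl_eq_zero (s := Icc a b), hres,
      integral_finsetSum_measure]
    · exact Finset.sum_congr rfl fun i _ => integral_dirac _ _
    · exact fun i _ => integrable_dirac (by simp)
    · have h0 : ∀ᵐ x ∂(seqConfig y).1, 0 < x := by
        rw [ae_iff]
        simp only [not_lt]
        exact (seqConfig y).2.1
      filter_upwards [h0] with x hx hxn
      rw [hout x hx hxn, Real.log_one]
  rw [configProd, hint, Real.exp_sum, seqProd, finprod_eq_prod_of_mulSupport_subset (s := hfin.toFinset)]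
  · refine Finset.prod_congr rfl fun i hi => ?_
    have hi' : y i ∈ Icc a b := by simpa using hi
    have : 0 < y i := ha.trans_le hi'.1
    rw [if_pos this, Real.exp_log (hpos _ this)]
  · intro i hi
    by_contra h
    refine hi ?_
    dsimp only
    split_ifs with h0
    · exact hout _ h0 (by simpa using h)
    · rfl

/-- The function `exp (-∑ⱼ nⱼ 1_{Iⱼ})`. -/
noncomputable def expWeight (n : RatInterval →₀ ℕ) (x : ℝ) : ℝ :=
  Real.exp (-n.sum fun j c => (c : ℝ) * j.toSet.indicator 1 x)

theorem isTestFunction_expWeight (n : RatInterval →₀ ℕ) : IsTestFunction (expWeight n) := by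
  have hnonneg : ∀ x, 0 ≤ n.sum fun j c => (c : ℝ) * j.toSet.indicator 1 x := fun x =>
    Finset.sum_nonneg fun j _ => mul_nonneg (Nat.cast_nonneg _)
      (indicator_nonneg (fun _ _ => zero_le_one) _)
  refine ⟨?_, fun x _ => (Real.exp_pos _).le, ?_, ?_⟩
  · unfold expWeight Finsupp.sum
    have : ∀ j : RatInterval, Measurable (j.toSet.indicator (1 : ℝ → ℝ)) := fun j =>
      measurable_one.indicator j.measurableSet
    fun_prop
  · have hb : ∃ a b : ℝ, 0 < a ∧ ∀ j ∈ n.support, j.toSet ⊆ Icc a b := by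
      classical
      induction n.support using Finset.induction_on with
      | empty => exact ⟨1, 1, one_pos, by simp⟩
      | insert j s _ ih =>
        obtain ⟨a, b, ha, h⟩ := ih
        refine ⟨min a j.1.1, max b j.2, lt_min ha (Rat.cast_pos.2 j.1.2), fun i hi => ?_⟩
        rcases Finset.mem_insert.1 hi with rfl | hi
        · exact fun x hx => ⟨(min_le_right _ _).trans hx.1.le, hx.2.trans (le_max_right _ _)⟩
        · exact (h i hi).trans (Icc_subset_Icc (min_le_left _ _) (le_max_left _ _))
    obtain ⟨a, b, ha, h⟩ := hb
    refine ⟨a, b, ha, fun x _ hx => ?_⟩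
    rw [expWeight, Finsupp.sum, Finset.sum_eq_zero, neg_zero, Real.exp_zero]
    intro j hj
    rw [indicator_of_notMem fun hxj => hx (h j hj hxj), mul_zero]
  -- The exponent is smallest where all the intervals overlap, so the values lie between `exp (-∑
  -- nⱼ)` and one.
  · refine ⟨1 - Real.exp (-n.sum fun _ c => (c : ℝ)), by linarith [Real.exp_pos (-n.sum fun _ c => (c : ℝ))],
      fun x _ => ?_⟩
    have h1 : expWeight n x ≤ 1 := Real.exp_le_one_iff.2 (neg_nonpos.2 (hnonneg x))
    have h2 : Real.exp (-n.sum fun _ c => (c : ℝ)) ≤ expWeight n x := by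
      refine Real.exp_le_exp.2 (neg_le_neg (Finset.sum_le_sum fun j _ => ?_))
      refine mul_le_of_le_one_right (Nat.cast_nonneg _) (indicator_le_self' ?_ _)
      exact fun _ _ => zero_le_one
    rw [abs_sub_comm, abs_of_nonneg (sub_nonneg.2 h1)]
    linarith

theorem configProd_expWeight (n : RatInterval →₀ ℕ) (η : PointConfig) :
    configProd (expWeight n) η = Real.exp (-weightedCount n η) := by
  rw [configProd]
  simp only [expWeight, Real.log_exp]
  rw [integral_neg]
  congr 2
  simp only [Finsupp.sum, weightedCount]
  rw [integral_finsetSum]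
  · refine Finset.sum_congr rfl fun j _ => ?_
    rw [integral_const_mul, integral_indicator_one j.measurableSet]
    rfl
  · intro j _
    refine Integrable.const_mul ?_ _
    rw [integrable_indicator_iff j.measurableSet]
    exact integrableOn_const (η.measure_ratInterval_ne_top j)

theorem intervalCount_addAtoms (j : RatInterval) (η : PointConfig) {k : ℕ} (z : Fin k → ℝ) :
    intervalCount (addAtoms η z) j = intervalCount η j +
      ((Measure.sum fun l => Measure.dirac (z l)).restrict (Ioi 0) j.toSet).toReal := by
  have h := (addAtoms η z).measure_ratInterval_ne_top j
  simp only [addAtoms, Measure.add_apply] at h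
  rw [ENNReal.add_ne_top] at h
  simp only [intervalCount, addAtoms, Measure.add_apply]
  exact ENNReal.toReal_add h.1 h.2

/-- Added atoms shift the weighted count by an amount that depends on `z` only, so their effect can
be compensated in the Palm formula. -/
theorem exists_weightedCount_addAtoms (n : RatInterval →₀ ℕ) (k : ℕ) :
    ∃ w : (Fin k → ℝ) → ℝ, Measurable w ∧
      ∀ η z, weightedCount n (addAtoms η z) = weightedCount n η + w z := by
  have hm : ∀ j : RatInterval, Measurable fun z : Fin k → ℝ =>
      ((Measure.sum fun l => Measure.dirac (z l)).restrict (Ioi 0) j.toSet).toReal := fun j =>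
    ((Measure.measurable_coe j.measurableSet).comp (measurable_sum_dirac_restrict
      (fun l => measurable_pi_apply l) measurableSet_Ioi)).ennreal_toReal
  refine ⟨fun z => n.sum fun j c => c *
    ((Measure.sum fun l => Measure.dirac (z l)).restrict (Ioi 0) j.toSet).toReal, ?_, ?_⟩
  · unfold Finsupp.sum
    fun_prop
  · intro η z
    simp only [weightedCount, intervalCount_addAtoms, mul_add, Finsupp.sum, Finset.sum_add_distrib]

/-! ### Reduced Palm distributions of lifted Poisson-Dirichlet processes -/

/-- The points at which the reduced Palm distributions are given by the explicit formula. -/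
def palmRegular (θ : ℝ) (ρ : Measure ℝ) (k : ℕ) : Set (Fin k → ℝ) :=
  {z | z ∈ posOrthant k ∧ liftedCorrelation θ ρ z ≠ 0 ∧ liftedCorrelation θ ρ z ≠ ∞}

open Classical in
/-- The explicit version of the reduced Palm distributions. -/
noncomputable def palmVersion {Ω : Type*} [MeasurableSpace Ω] (θ : ℝ) (ρ : Measure ℝ)
    (P : Measure Ω) (X : Ω → RankedSimplex) {k : ℕ} (z : Fin k → ℝ) : Measure PointConfig :=
  if z ∈ palmRegular θ ρ k then
    (liftedCorrelation θ ρ z)⁻¹ • ((ρ.prod P).withDensity fun p => scaledPalmWeight θ p.1 z).map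
      fun p => seqConfig ((p.1 - ∑ l, z l) • (X p.2 : ℕ → ℝ))
  else Measure.dirac (seqConfig 0)

theorem mem_palmRegular {θ : ℝ} (hθ : 0 < θ) {ρ : Measure ℝ} {k : ℕ} {z : Fin k → ℝ}
    (hz : z ∈ posOrthant k) (hρ : 0 < ρ (Ioi (∑ l, z l))) (hfin : liftedCorrelation θ ρ z < ∞) :
    z ∈ palmRegular θ ρ k :=
  ⟨hz, fun h => hρ.ne' ((liftedCorrelation_eq_zero_iff hθ hz).1 h), hfin.ne⟩

/-- The right side of the identity does not involve the measure, and the functions `expWeight n`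
already suffice to determine it. -/
theorem SatisfiesPalmIdentity.eq {Ω : Type*} [MeasurableSpace Ω] {P : Measure Ω} {θ : ℝ}
    {X : Ω → RankedSimplex} {ρ : Measure ℝ} {k : ℕ} {z : Fin k → ℝ} {Q₁ Q₂ : Measure PointConfig}
    [IsFiniteMeasure Q₁] [IsFiniteMeasure Q₂] (h₁ : SatisfiesPalmIdentity θ ρ P X z Q₁)
    (h₂ : SatisfiesPalmIdentity θ ρ P X z Q₂) : Q₁ = Q₂ := by
  refine PointConfig.measure_ext fun n => ?_
  simp only [← configProd_expWeight]
  rw [h₁ _ (isTestFunction_expWeight n), h₂ _ (isTestFunction_expWeight n)]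

theorem ae_pos_of_map {Ω : Type*} [MeasurableSpace Ω] {P : Measure Ω} {V : Ω → Ioi (0 : ℝ)}
    {ρ : Measure ℝ} (hV : Measurable V) (hρ : ρ = P.map (fun ω => (V ω : ℝ))) :
    ∀ᵐ v ∂ρ, 0 < v := by
  rw [hρ, ae_map_iff (by fun_prop) measurableSet_Ioi]
  exact ae_of_all _ fun ω => (V ω).2

section

variable {Ω : Type*} [MeasurableSpace Ω] {P : Measure Ω} [IsProbabilityMeasure P] {θ : ℝ}
  {X : Ω → RankedSimplex} {ρ : Measure ℝ} {k : ℕ}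

theorem lintegral_palmVersion (hX : Measurable X) {z : Fin k → ℝ} (hz : z ∈ palmRegular θ ρ k)
    {f : PointConfig → ℝ≥0∞} (hf : Measurable f) :
    ∫⁻ η, f η ∂palmVersion θ ρ P X z = (liftedCorrelation θ ρ z)⁻¹ *
      ∫⁻ v, scaledPalmWeight θ v z *
        ∫⁻ ω, f (seqConfig ((v - ∑ l, z l) • (X ω : ℕ → ℝ))) ∂P ∂ρ := by
  have hg : Measurable fun p : ℝ × Ω => seqConfig ((p.1 - ∑ l, z l) • (X p.2 : ℕ → ℝ)) := by
    fun_prop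
  have hw : Measurable fun p : ℝ × Ω => scaledPalmWeight θ p.1 z := by fun_prop
  rw [palmVersion, if_pos hz, lintegral_smul_measure, lintegral_map hf hg,
    lintegral_withDensity_eq_lintegral_mul _ hw
      (by fun_prop : Measurable fun p : ℝ × Ω => f (seqConfig ((p.1 - ∑ l, z l) • (X p.2 : ℕ → ℝ)))),
    smul_eq_mul]
  simp only [Pi.mul_apply]
  rw [lintegral_prod _ (by fun_prop)]
  congr 1
  refine lintegral_congr fun v => ?_
  dsimp only
  rw [lintegral_const_mul]
  fun_prop

theorem isProbabilityMeasure_palmVersion (hθ : 0 < θ) (hX : Measurable X) (z : Fin k → ℝ) :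
    IsProbabilityMeasure (palmVersion θ ρ P X z) := by
  by_cases hz : z ∈ palmRegular θ ρ k
  · refine ⟨?_⟩
    have h := lintegral_palmVersion (P := P) hX hz (f := fun _ => 1) measurable_const
    simp only [lintegral_const, measure_univ, mul_one, one_mul] at h
    rw [h, lintegral_scaledPalmWeight hθ hz.1]
    exact ENNReal.inv_mul_cancel hz.2.1 hz.2.2
  · rw [palmVersion, if_neg hz]
    infer_instance

theorem satisfiesPalmIdentity_palmVersion (hθ : 0 < θ) (hX : Measurable X) {z : Fin k → ℝ}
    (hz : z ∈ palmRegular θ ρ k) : SatisfiesPalmIdentity θ ρ P X z (palmVersion θ ρ P X z) := by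
  intro φ hφ
  have hconf : ∀ v ω, configProd φ (seqConfig ((v - ∑ l, z l) • (X ω : ℕ → ℝ))) =
      seqProd φ fun i => (v - ∑ l, z l) * (X ω : ℕ → ℝ) i := fun v ω =>
    configProd_seqConfig hφ (.of_summable ((X ω).2.2.2.summable.mul_left _))
  have hc := measurable_configProd hφ.1
  have hp : 0 < ∏ l, z l := Finset.prod_pos fun l _ => hz.1 l
  have hc0 : ENNReal.ofReal (θ ^ k / ∏ l, z l) ≠ 0 := (ENNReal.ofReal_pos.2 (by positivity)).ne'
  rw [lintegral_palmVersion hX hz (by fun_prop), lintegral_scaledPalmWeight_mul hθ hz.1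
    (by fun_prop), liftedCorrelation]
  simp only [hconf]
  -- The factor `θ^k / (z₁ ⋯ z_k)` cancels between the weight and the normalization, leaving
  -- `palmMass` as denominator.
  rw [ENNReal.mul_inv (.inl hc0) (.inl ENNReal.ofReal_ne_top), mul_comm (ENNReal.ofReal _)⁻¹,
    mul_assoc, ← mul_assoc (ENNReal.ofReal _)⁻¹, ENNReal.inv_mul_cancel hc0 ENNReal.ofReal_ne_top,
    one_mul, mul_comm, ENNReal.div_eq_inv_mul, mul_comm]

variable [IsProbabilityMeasure ρ]

theorem measurableSet_palmRegular : MeasurableSet (palmRegular θ ρ k) := by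
  have hm := measurable_liftedCorrelation (θ := θ) (ρ := ρ) (k := k)
  exact (measurableSet_posOrthant k).inter ((hm (measurableSet_singleton 0).compl).inter
    (hm (measurableSet_singleton ∞).compl))

theorem measurable_palmVersion (hX : Measurable X) :
    Measurable fun z : Fin k → ℝ => palmVersion θ ρ P X z := by
  classical
  refine Measure.measurable_of_measurable_coe _ fun s hs => ?_
  have h : ∀ z : Fin k → ℝ, palmVersion θ ρ P X z s = if z ∈ palmRegular θ ρ k then
      (liftedCorrelation θ ρ z)⁻¹ * ∫⁻ v, scaledPalmWeight θ v z *
        ∫⁻ ω, s.indicator 1 (seqConfig ((v - ∑ l, z l) • (X ω : ℕ → ℝ))) ∂P ∂ρ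
      else Measure.dirac (seqConfig 0) s := by
    intro z
    by_cases hz : z ∈ palmRegular θ ρ k
    · rw [if_pos hz, ← lintegral_palmVersion hX hz (measurable_one.indicator hs),
        lintegral_indicator_one hs]
    · rw [if_neg hz, palmVersion, if_neg hz]
  simp only [h]
  have hm := measurable_liftedCorrelation (θ := θ) (ρ := ρ) (k := k)
  have hsm : Measurable (s.indicator (1 : PointConfig → ℝ≥0∞)) := measurable_one.indicator hs
  exact Measurable.ite measurableSet_palmRegular (by fun_prop) measurable_const

/-- The kernel of the explicit reduced Palm distributions. -/
noncomputable def palmKernel (θ : ℝ) (ρ : Measure ℝ) [IsProbabilityMeasure ρ] (P : Measure Ω)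
    [IsProbabilityMeasure P] (hX : Measurable X) (k : ℕ) : Kernel (Fin k → ℝ) PointConfig :=
  ⟨fun z => palmVersion θ ρ P X z, measurable_palmVersion hX⟩

end

section

variable {Ω : Type*} [MeasurableSpace Ω] {P : Measure Ω} [IsProbabilityMeasure P] {θ : ℝ}
  {X : Ω → RankedSimplex} {V : Ω → Ioi (0 : ℝ)} {ρ : Measure ℝ} [IsProbabilityMeasure ρ]

theorem lintegral_correlationMeasure_liftSeq (hθ : 0 < θ) (hX : Measurable X) (hV : Measurable V)
    (hPD : P.map (fun ω => (X ω : ℕ → ℝ)) = poissonDirichlet θ hθ) (hindep : IndepFun V X P)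
    (hρ : ρ = P.map (fun ω => (V ω : ℝ))) {k : ℕ} {f : (Fin k → ℝ) → ℝ≥0∞} (hf : Measurable f) :
    ∫⁻ z, f z ∂correlationMeasure P (fun ω => liftSeq (V ω) (X ω)) k =
      ∫⁻ z in posOrthant k, liftedCorrelation θ ρ z * f z := by
  rw [correlationMeasure_liftSeq hθ hX hV hPD hindep hρ,
    lintegral_withDensity_eq_lintegral_mul _ measurable_liftedCorrelation hf]
  rfl

theorem ae_mem_palmRegular (hθ : 0 < θ) (hX : Measurable X) (hV : Measurable V)
    (hPD : P.map (fun ω => (X ω : ℕ → ℝ)) = poissonDirichlet θ hθ) (hindep : IndepFun V X P)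
    (hρ : ρ = P.map (fun ω => (V ω : ℝ))) (k : ℕ) :
    ∀ᵐ z ∂correlationMeasure P (fun ω => liftSeq (V ω) (X ω)) k, z ∈ palmRegular θ ρ k := by
  rw [correlationMeasure_liftSeq hθ hX hV hPD hindep hρ,
    ae_withDensity_iff measurable_liftedCorrelation]
  filter_upwards [ae_restrict_mem (measurableSet_posOrthant k), ae_restrict_of_ae
    (ae_liftedCorrelation_lt_top hθ hX hPD (ae_pos_of_map hV hρ) k)] with z hz hfin h0
  exact ⟨hz, h0, (hfin hz).ne⟩

/-- The normalization by `r_k(z)` cancels against the density of the correlation measure, which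
returns the Palm formula with random mass. -/
theorem isReducedPalm_palmKernel (hθ : 0 < θ) (hX : Measurable X) (hV : Measurable V)
    (hPD : P.map (fun ω => (X ω : ℕ → ℝ)) = poissonDirichlet θ hθ) (hindep : IndepFun V X P)
    (hρ : ρ = P.map (fun ω => (V ω : ℝ))) (k : ℕ) :
    IsReducedPalm P (fun ω => liftSeq (V ω) (X ω)) k (palmKernel θ ρ P hX k) := by
  intro G hG
  have : IsMarkovKernel (palmKernel θ ρ P hX k) := ⟨isProbabilityMeasure_palmVersion hθ hX⟩
  have hGu : Measurable (Function.uncurry fun z η => G (z, η)) := hG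
  have hin : Measurable fun z => ∫⁻ η, G (z, addAtoms η z) ∂palmKernel θ ρ P hX k z :=
    Measurable.lintegral_kernel_prod_right' (f := fun p => G (p.1, addAtoms p.2 p.1)) (by fun_prop)
  rw [lintegral_factorialMeasure_liftSeq hθ hX hV hPD hindep hρ hGu,
    lintegral_correlationMeasure_liftSeq hθ hX hV hPD hindep hρ hin,
    ← lintegral_indicator (measurableSet_posOrthant k)]
  refine lintegral_congr_ae ?_
  filter_upwards [ae_liftedCorrelation_lt_top hθ hX hPD (ae_pos_of_map hV hρ) k] with z hfin
  by_cases hz : z ∈ posOrthant k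
  · rw [indicator_of_mem hz]
    -- Where `r_k(z) = 0`, `ρ` does not charge `(|z|, ∞)` and both sides vanish, whatever default
    -- law the kernel has there.
    by_cases h0 : liftedCorrelation θ ρ z = 0
    · rw [h0, zero_mul, lintegral_scaledPalmWeight_mul hθ hz (by fun_prop), ← mul_zero]
      congr 1
      exact setLIntegral_measure_zero _ _ ((liftedCorrelation_eq_zero_iff hθ hz).1 h0)
    · have hreg : z ∈ palmRegular θ ρ k := ⟨hz, h0, (hfin hz).ne⟩
      change _ = liftedCorrelation θ ρ z * ∫⁻ η, G (z, addAtoms η z) ∂palmVersion θ ρ P X z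
      rw [lintegral_palmVersion hX hreg (by fun_prop), ← mul_assoc,
        ENNReal.mul_inv_cancel h0 (hfin hz).ne, one_mul]
  · simp [indicator_of_notMem hz, scaledPalmWeight_eq_zero hz]

theorem sigmaFinite_correlationMeasure (hθ : 0 < θ) (hX : Measurable X) (hV : Measurable V)
    (hPD : P.map (fun ω => (X ω : ℕ → ℝ)) = poissonDirichlet θ hθ) (hindep : IndepFun V X P)
    (hρ : ρ = P.map (fun ω => (V ω : ℝ))) (k : ℕ) :
    SigmaFinite (correlationMeasure P (fun ω => liftSeq (V ω) (X ω)) k) := by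
  rw [correlationMeasure_liftSeq hθ hX hV hPD hindep hρ]
  refine SigmaFinite.withDensity_of_ne_top ?_
  filter_upwards [ae_restrict_mem (measurableSet_posOrthant k), ae_restrict_of_ae
    (ae_liftedCorrelation_lt_top hθ hX hPD (ae_pos_of_map hV hρ) k)] with z hz hfin
  exact (hfin hz).ne

end

/-- Reduced Palm distributions are unique almost everywhere. -/
theorem IsReducedPalm.ae_eq {Ω : Type*} [MeasurableSpace Ω] {P : Measure Ω}
    {Z : Ω → RankedCone} {k : ℕ} [SigmaFinite (correlationMeasure P Z k)]
    {Q₁ Q₂ : Kernel (Fin k → ℝ) PointConfig} [IsMarkovKernel Q₁] [IsMarkovKernel Q₂]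
    (h₁ : IsReducedPalm P Z k Q₁) (h₂ : IsReducedPalm P Z k Q₂) :
    ∀ᵐ z ∂correlationMeasure P Z k, Q₁ z = Q₂ z := by
  have hn : ∀ n : RatInterval →₀ ℕ, ∀ᵐ z ∂correlationMeasure P Z k,
      ∫⁻ η, ENNReal.ofReal (Real.exp (-weightedCount n η)) ∂Q₁ z =
        ∫⁻ η, ENNReal.ofReal (Real.exp (-weightedCount n η)) ∂Q₂ z := by
    intro n
    obtain ⟨w, hw, hwn⟩ := exists_weightedCount_addAtoms n k
    have hmeas : ∀ (Q : Kernel (Fin k → ℝ) PointConfig) [IsMarkovKernel Q],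
        Measurable fun z => ∫⁻ η, ENNReal.ofReal (Real.exp (-weightedCount n η)) ∂Q z := fun Q _ =>
      Measurable.lintegral_kernel (by fun_prop)
    refine ae_eq_of_forall_setLIntegral_eq_of_sigmaFinite (hmeas Q₁) (hmeas Q₂) fun s hs _ => ?_
    -- The factor `exp (w z)` cancels the contribution of the added atoms, so the Palm formula
    -- integrates the Laplace functional of `Q z` itself over `s`.
    let G : (Fin k → ℝ) × PointConfig → ℝ≥0∞ := fun p =>
      s.indicator 1 p.1 * ENNReal.ofReal (Real.exp (w p.1 - weightedCount n p.2))
    have hsm : Measurable (s.indicator (1 : (Fin k → ℝ) → ℝ≥0∞)) := measurable_one.indicator hs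
    have hG : Measurable G := by fun_prop
    have key : ∀ Q : Kernel (Fin k → ℝ) PointConfig, ∀ z, ∫⁻ η, G (z, addAtoms η z) ∂Q z =
        s.indicator (fun z => ∫⁻ η, ENNReal.ofReal (Real.exp (-weightedCount n η)) ∂Q z) z := by
      intro Q z
      simp only [G, hwn, sub_add_cancel_right]
      by_cases hz : z ∈ s <;> simp [hz]
    have e := (h₁ G hG).symm.trans (h₂ G hG)
    simp only [key] at e
    rwa [lintegral_indicator hs, lintegral_indicator hs] at e
  filter_upwards [ae_all_iff.2 hn] with z hz using PointConfig.measure_ext hz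

/-! ### Mecke's formula characterizes Poisson processes -/

/-- Integrality is postulated only inside compact intervals of `(0, ∞)`. Exhausting `A` by such
pieces gives a bounded increasing sequence of natural numbers, which attains its supremum. -/
theorem PointConfig.measure_eq_natCast (η : PointConfig) {A : Set ℝ} (hA : MeasurableSet A)
    (hfin : η.1 A ≠ ∞) : ∃ n : ℕ, η.1 A = n := by
  have hmono : Monotone fun m : ℕ => A ∩ Icc (1 / ((m : ℝ) + 1)) m := by
    intro m m' h
    have h' : (m : ℝ) ≤ m' := by exact_mod_cast h
    refine inter_subset_inter_right _ (Icc_subset_Icc ?_ h')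
    gcongr
  have hU : ⋃ m : ℕ, A ∩ Icc (1 / ((m : ℝ) + 1)) m = A ∩ Ioi 0 := by
    rw [← inter_iUnion]
    congr 1
    ext x
    simp only [mem_iUnion, mem_Icc, mem_Ioi]
    constructor
    · rintro ⟨m, h, -⟩
      exact lt_of_lt_of_le (by positivity) h
    · intro hx
      obtain ⟨m, hm⟩ := exists_nat_one_div_lt hx
      obtain ⟨m', hm'⟩ := exists_nat_ge x
      refine ⟨max m m', ?_, hm'.trans ?_⟩
      · refine le_trans ?_ hm.le
        gcongr
        exact le_max_left _ _
      · exact_mod_cast le_max_right _ _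
  have hsup : η.1 A = ⨆ m : ℕ, η.1 (A ∩ Icc (1 / ((m : ℝ) + 1)) m) := by
    rw [← hmono.measure_iUnion, hU, measure_inter_conull]
    rw [compl_Ioi]
    exact η.2.1
  have hnat : ∀ m : ℕ, ∃ n : ℕ, η.1 (A ∩ Icc (1 / ((m : ℝ) + 1)) m) = n := fun m =>
    η.2.2 _ m (by positivity) _ (hA.inter measurableSet_Icc) inter_subset_right
  choose f hf using hnat
  have hbdd : BddAbove (range f) := by
    obtain ⟨C, hC⟩ := ENNReal.exists_nat_gt hfin
    refine ⟨C, ?_⟩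
    rintro _ ⟨m, rfl⟩
    have : (f m : ℝ≥0∞) ≤ C := by
      rw [← hf m]
      exact (measure_mono inter_subset_left).trans hC.le
    exact_mod_cast this
  obtain ⟨m₀, hm₀⟩ := Nat.sSup_mem (range_nonempty f) hbdd
  refine ⟨f m₀, ?_⟩
  rw [hsup]
  refine le_antisymm (iSup_le fun m => ?_) ?_
  · rw [hf m, hm₀]
    exact_mod_cast le_csSup hbdd ⟨m, rfl⟩
  · rw [← hf m₀]
    exact le_iSup (fun m : ℕ => η.1 (A ∩ Icc (1 / ((m : ℝ) + 1)) m)) m₀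

theorem addAtoms_one_apply (η : PointConfig) {z : ℝ} (hz : 0 < z) {A : Set ℝ}
    (hA : MeasurableSet A) :
    (addAtoms η fun _ : Fin 1 => z).1 A = η.1 A + A.indicator 1 z := by
  simp only [addAtoms, Measure.add_apply]
  congr 1
  rw [Measure.restrict_apply hA, Measure.sum_apply _ (hA.inter measurableSet_Ioi), tsum_fintype]
  simp only [Finset.univ_unique, Finset.sum_singleton]
  rw [Measure.dirac_apply' _ (hA.inter measurableSet_Ioi)]
  by_cases h : z ∈ A <;> simp [indicator, h, hz]

section

variable {Ω : Type*} [MeasurableSpace Ω] {P : Measure Ω}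
  {ξ : Ω → PointConfig} {μ : Measure ℝ}

/-- Mecke's formula for the point process `ξ` with mean measure `μ`. -/
def MeckeFormula (P : Measure Ω) (ξ : Ω → PointConfig) (μ : Measure ℝ) : Prop :=
  ∀ G : ℝ → PointConfig → ℝ≥0∞, Measurable (Function.uncurry G) →
    ∫⁻ ω, ∫⁻ x, G x (ξ ω) ∂(ξ ω).1 ∂P =
      ∫⁻ z, ∫⁻ ω, G z (addAtoms (ξ ω) fun _ : Fin 1 => z) ∂P ∂μ

theorem measurable_pointConfig_apply {A : Set ℝ} (hA : MeasurableSet A) :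
    Measurable fun η : PointConfig => η.1 A :=
  (Measure.measurable_coe hA).comp measurable_subtype_coe

/-- Mecke's formula for `1_A(x) 1{η(A) = n + 1, η ∈ B}`: each of the `n + 1` points in `A` counts
once on the left, while on the right the added point raises the count from `n` and does not affect
`B`. -/
theorem MeckeFormula.measure_succ (h : MeckeFormula P ξ μ) (hξ : Measurable ξ)
    (hμ : ∀ᵐ z ∂μ, 0 < z) {A : Set ℝ} (hA : MeasurableSet A) {B : Set PointConfig}
    (hB : MeasurableSet B)
    (hinv : ∀ η z, 0 < z → z ∈ A → ((addAtoms η fun _ : Fin 1 => z) ∈ B ↔ η ∈ B)) (n : ℕ) :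
    ((n + 1 : ℕ) : ℝ≥0∞) * P {ω | (ξ ω).1 A = (n + 1 : ℕ) ∧ ξ ω ∈ B} =
      μ A * P {ω | (ξ ω).1 A = n ∧ ξ ω ∈ B} := by
  have hS : ∀ m : ℕ, MeasurableSet {η : PointConfig | η.1 A = m ∧ η ∈ B} := fun m =>
    (measurable_pointConfig_apply hA (measurableSet_singleton _)).inter hB
  have hSm : ∀ m : ℕ, Measurable ({η : PointConfig | η.1 A = m ∧ η ∈ B}.indicator
      (1 : PointConfig → ℝ≥0∞)) := fun m => measurable_one.indicator (hS m)
  have hAm : Measurable (A.indicator (1 : ℝ → ℝ≥0∞)) := measurable_one.indicator hA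
  have e := h (fun x η => A.indicator 1 x *
    {η : PointConfig | η.1 A = (n + 1 : ℕ) ∧ η ∈ B}.indicator 1 η) (by
      have := hSm (n + 1)
      fun_prop)
  have hind : ∀ m : ℕ, ∫⁻ ω, {η : PointConfig | η.1 A = m ∧ η ∈ B}.indicator 1 (ξ ω) ∂P =
      P {ω | (ξ ω).1 A = m ∧ ξ ω ∈ B} := fun m => by
    rw [← lintegral_map (hSm m) hξ, lintegral_indicator_one (hS m), Measure.map_apply hξ (hS m)]
    rfl
  have eL : ∫⁻ ω, ∫⁻ x, A.indicator 1 x *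
      {η : PointConfig | η.1 A = (n + 1 : ℕ) ∧ η ∈ B}.indicator 1 (ξ ω) ∂(ξ ω).1 ∂P =
      ((n + 1 : ℕ) : ℝ≥0∞) * P {ω | (ξ ω).1 A = (n + 1 : ℕ) ∧ ξ ω ∈ B} := by
    rw [← hind, ← lintegral_const_mul]
    swap
    · exact (hSm _).comp hξ
    refine lintegral_congr fun ω => ?_
    rw [lintegral_mul_const _ hAm, lintegral_indicator_one hA]
    by_cases hω : ξ ω ∈ {η : PointConfig | η.1 A = (n + 1 : ℕ) ∧ η ∈ B}
    · rw [indicator_of_mem hω, hω.1]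
    · rw [indicator_of_notMem hω, mul_zero, mul_zero]
  have eR : ∫⁻ z, ∫⁻ ω, A.indicator 1 z * {η : PointConfig | η.1 A = (n + 1 : ℕ) ∧ η ∈ B}.indicator 1
      (addAtoms (ξ ω) fun _ : Fin 1 => z) ∂P ∂μ = μ A * P {ω | (ξ ω).1 A = n ∧ ξ ω ∈ B} := by
    rw [← lintegral_indicator_one hA, ← lintegral_mul_const _ hAm]
    refine lintegral_congr_ae ?_
    filter_upwards [hμ] with z hz
    by_cases hzA : z ∈ A
    · rw [indicator_of_mem hzA, ← hind]
      simp only [Pi.one_apply, one_mul]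
      refine lintegral_congr fun ω => ?_
      have : (addAtoms (ξ ω) fun _ : Fin 1 => z) ∈
          {η : PointConfig | η.1 A = (n + 1 : ℕ) ∧ η ∈ B} ↔
          ξ ω ∈ {η : PointConfig | η.1 A = n ∧ η ∈ B} := by
        simp only [mem_ofPred_eq, addAtoms_one_apply _ hz hA, indicator_of_mem hzA, Pi.one_apply,
          hinv _ z hz hzA, Nat.cast_add, Nat.cast_one, ENNReal.add_left_inj ENNReal.one_ne_top]
      by_cases hω : ξ ω ∈ {η : PointConfig | η.1 A = n ∧ η ∈ B}
      · rw [indicator_of_mem hω, indicator_of_mem (this.2 hω)]; rfl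
      · rw [indicator_of_notMem hω, indicator_of_notMem (fun h => hω (this.1 h))]
    · simp [indicator_of_notMem hzA]
  rw [← eL, e, eR]

theorem MeckeFormula.ae_ne_top (h : MeckeFormula P ξ μ) (hξ : Measurable ξ) [IsFiniteMeasure P]
    {A : Set ℝ} (hA : MeasurableSet A) (hfin : μ A ≠ ∞) : ∀ᵐ ω ∂P, (ξ ω).1 A ≠ ∞ := by
  have hAm : Measurable (A.indicator (1 : ℝ → ℝ≥0∞)) := measurable_one.indicator hA
  have e := h (fun x _ => A.indicator 1 x) (by fun_prop)
  simp only [lintegral_indicator_one hA, lintegral_const] at e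
  rw [lintegral_mul_const _ hAm, lintegral_indicator_one hA] at e
  have : ∫⁻ ω, (ξ ω).1 A ∂P ≠ ∞ := by
    rw [e]
    exact ENNReal.mul_ne_top hfin (measure_ne_top _ _)
  filter_upwards [ae_lt_top ((measurable_pointConfig_apply hA).comp hξ) this] with ω hω using hω.ne

variable [IsProbabilityMeasure P]

/-- The recursion gives `p n = m^n / n! * p 0`, and summing over `n` gives `p 0 = exp (-m) P(ξ ∈
B)`. Carrying an event `B` unaffected by points in `A` yields independence together with the Poisson
law. -/
theorem MeckeFormula.map_restrict (h : MeckeFormula P ξ μ) (hξ : Measurable ξ)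
    (hμ : ∀ᵐ z ∂μ, 0 < z) {A : Set ℝ} (hA : MeasurableSet A) (hfin : μ A ≠ ∞)
    {B : Set PointConfig} (hB : MeasurableSet B)
    (hinv : ∀ η z, 0 < z → z ∈ A → ((addAtoms η fun _ : Fin 1 => z) ∈ B ↔ η ∈ B)) :
    (P.restrict (ξ ⁻¹' B)).map (fun ω => (ξ ω).1 A) =
      P (ξ ⁻¹' B) • (poissonMeasure (μ A).toNNReal).map fun n : ℕ => (n : ℝ≥0∞) := by
  have hAξ : Measurable fun ω => (ξ ω).1 A := (measurable_pointConfig_apply hA).comp hξ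
  -- An infinite count is sent to zero here; it occurs with probability zero because the mean count
  -- is finite.
  let N : Ω → ℕ := fun ω => ⌊((ξ ω).1 A).toReal⌋₊
  have hN : Measurable N := Nat.measurable_floor.comp hAξ.ennreal_toReal
  have hNeq : ∀ᵐ ω ∂P, (ξ ω).1 A = N ω := by
    filter_upwards [h.ae_ne_top hξ hA hfin] with ω hω
    obtain ⟨n, hn⟩ := (ξ ω).measure_eq_natCast hA hω
    simp [N, hn]
  have hBξ := hξ hB
  let p : ℕ → ℝ := fun n => P.real {ω | (ξ ω).1 A = n ∧ ξ ω ∈ B}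
  set m : ℝ := (μ A).toReal with hm
  have hrec : ∀ n : ℕ, ((n : ℝ) + 1) * p (n + 1) = m * p n := fun n => by
    have e := congrArg ENNReal.toReal (h.measure_succ hξ hμ hA hB hinv n)
    rw [ENNReal.toReal_mul, ENNReal.toReal_mul, ENNReal.toReal_natCast] at e
    simpa [p, measureReal_def] using e
  have hpn : ∀ n : ℕ, p n = m ^ n / n.factorial * p 0 := by
    intro n
    induction n with
    | zero => simp
    | succ n ih =>
      have h1 : ((n : ℝ) + 1) ≠ 0 := by positivity
      have h2 : (n.factorial : ℝ) ≠ 0 := by positivity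
      have := hrec n
      rw [ih] at this
      rw [Nat.factorial_succ, Nat.cast_mul, Nat.cast_succ]
      field_simp
      field_simp at this
      linear_combination this
  have hset : ∀ n : ℕ, P (N ⁻¹' {n} ∩ ξ ⁻¹' B) = ENNReal.ofReal (p n) := fun n => by
    rw [ofReal_measureReal]
    refine measure_congr ?_
    filter_upwards [hNeq] with ω hω
    refine propext ?_
    change (N ω = n ∧ ξ ω ∈ B) ↔ ((ξ ω).1 A = n ∧ ξ ω ∈ B)
    rw [hω, Nat.cast_inj]
  have hsum : ∑' n, ENNReal.ofReal (p n) = P (ξ ⁻¹' B) := by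
    simp only [← hset]
    rw [← measure_iUnion]
    · rw [← iUnion_inter, ← preimage_iUnion, iUnion_of_singleton, preimage_univ, univ_inter]
    · intro i j hij
      refine Disjoint.mono inter_subset_left inter_subset_left (Disjoint.preimage _ ?_)
      simpa using hij
    · exact fun n => (hN (measurableSet_singleton n)).inter hBξ
  have hexp : HasSum (fun n : ℕ => m ^ n / n.factorial * p 0) (Real.exp m * p 0) := by
    have := NormedSpace.expSeries_div_hasSum_exp (m : ℝ)
    rw [← Real.exp_eq_exp_ℝ] at this
    exact this.mul_right _
  have hp0 : Real.exp m * p 0 = P.real (ξ ⁻¹' B) := by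
    have hnn : ∀ n, 0 ≤ p n := fun n => measureReal_nonneg
    have hps : HasSum p (Real.exp m * p 0) := by
      convert hexp using 1
      exact funext hpn
    rw [measureReal_def, ← hsum, ← ENNReal.ofReal_tsum_of_nonneg hnn hps.summable, hps.tsum_eq,
      ENNReal.toReal_ofReal (mul_nonneg (Real.exp_pos _).le (hnn 0))]
  have hmap : (P.restrict (ξ ⁻¹' B)).map N = P (ξ ⁻¹' B) • poissonMeasure (μ A).toNNReal := by
    refine Measure.ext_of_singleton fun n => ?_
    rw [Measure.map_apply hN (measurableSet_singleton n), Measure.restrict_apply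
      (hN (measurableSet_singleton n)), hset, Measure.smul_apply, poissonMeasure_singleton,
      smul_eq_mul, ← ofReal_measureReal (μ := P), ← ENNReal.ofReal_mul measureReal_nonneg, ← hp0, hpn]
    congr 1
    have : (((μ A).toNNReal : ℝ≥0) : ℝ) = m := rfl
    rw [this, Real.exp_neg]
    field_simp
  have hcast : Measurable fun n : ℕ => (n : ℝ≥0∞) := measurable_from_top
  rw [Measure.map_congr (ae_restrict_of_ae hNeq), ← Measure.map_smul, ← hmap,
    Measure.map_map hcast hN]
  rfl

theorem MeckeFormula.isPoisson (h : MeckeFormula P ξ μ) (hξ : Measurable ξ)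
    (hμ : ∀ᵐ z ∂μ, 0 < z) : IsPoissonProcess P ξ μ := by
  have hlaw : ∀ A : Set ℝ, MeasurableSet A → μ A ≠ ∞ → P.map (fun ω => (ξ ω).1 A) =
      (poissonMeasure (μ A).toNNReal).map fun n : ℕ => (n : ℝ≥0∞) := fun A hA hfin => by
    simpa using h.map_restrict hξ hμ hA hfin MeasurableSet.univ (by simp)
  refine ⟨hξ, hlaw, fun n A hA hfin hdisj => ?_⟩
  rw [iIndepFun_iff_measure_inter_preimage_eq_mul]
  intro S
  induction S using Finset.induction_on with
  | empty => intro sets _; simp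
  | insert a S ha ih =>
    intro sets hsets
    have hm : ∀ i, Measurable fun ω => (ξ ω).1 (A i) := fun i =>
      (measurable_pointConfig_apply (hA i)).comp hξ
    -- The event fixes counts on sets disjoint from `A a`, so a point added in `A a` leaves it
    -- unchanged.
    let B : Set PointConfig := ⋂ i ∈ S, {η | η.1 (A i) ∈ sets i}
    have hB : MeasurableSet B := Finset.measurableSet_biInter S fun i hi =>
      measurable_pointConfig_apply (hA i) (hsets i (Finset.mem_insert_of_mem hi))
    have hpre : ⋂ i ∈ S, (fun ω => (ξ ω).1 (A i)) ⁻¹' sets i = ξ ⁻¹' B := by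
      ext ω; simp [B]
    have hinv : ∀ η z, 0 < z → z ∈ A a → ((addAtoms η fun _ : Fin 1 => z) ∈ B ↔ η ∈ B) := by
      intro η z hz hzA
      simp only [B, mem_iInter, mem_ofPred_eq]
      refine forall₂_congr fun i hi => ?_
      have hia : a ≠ i := fun h => ha (h ▸ hi)
      rw [addAtoms_one_apply _ hz (hA i),
        indicator_of_notMem (disjoint_left.1 (hdisj hia) hzA), add_zero]
    have hsa := hsets a (Finset.mem_insert_self a S)
    have hr := congrArg (fun ν => ν (sets a)) (h.map_restrict hξ hμ (hA a) (hfin a) hB hinv)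
    simp only [Measure.smul_apply, smul_eq_mul] at hr
    rw [← hlaw (A a) (hA a) (hfin a), Measure.map_apply (hm a) hsa, Measure.map_apply (hm a) hsa,
      Measure.restrict_apply (hm a hsa)] at hr
    rw [Finset.set_biInter_insert, Finset.prod_insert ha,
      ← ih fun i hi => hsets i (Finset.mem_insert_of_mem hi), hpre, hr, mul_comm]

end

/-! ### The gamma case -/

theorem lintegral_factorialMeasure_one {y : ℕ → ℝ} (hy : TermsLocallyFinite y) {f : ℝ → ℝ≥0∞}
    (hf : Measurable f) :
    ∫⁻ z, f (z 0) ∂factorialMeasure 1 y = ∫⁻ x, f x ∂(seqConfig y).1 := by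
  rw [lintegral_factorialMeasure _ (by fun_prop), tsum_embedding_succ, seqConfig_val hy,
    ← lintegral_indicator measurableSet_Ioi, lintegral_sum_measure]
  refine tsum_congr fun i => ?_
  rw [tsum_eq_single (Function.Embedding.ofIsEmpty) fun e he => absurd (Subsingleton.elim _ _) he,
    lintegral_dirac' _ (hf.indicator measurableSet_Ioi)]
  by_cases h : 0 < y i
  · rw [indicator_of_mem (show y i ∈ Ioi 0 from h), indicator_of_mem]
    · simp
    · intro l
      rw [Subsingleton.elim l 0]
      simpa using h
  · rw [indicator_of_notMem (show y i ∉ Ioi 0 from h), indicator_of_notMem]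
    intro hl
    exact h (by simpa using hl 0)

/-- What is special about the gamma law: `(u / (u + x))^(θ - 1)` replaces the power `(u + x)^(θ -
1)` by `u^(θ - 1)`, and the exponential splits. The point `u = 0` is excluded: the left side
vanishes there, the right side need not. -/
theorem gammaPDF_add_mul_scaledPalmWeight {θ b x u : ℝ} (hθ : 0 < θ) (hb : 0 < b) (hx : 0 < x)
    (hu : u ≠ 0) :
    gammaPDF θ b (u + x) * scaledPalmWeight θ (u + x) (fun _ : Fin 1 => x) =
      ENNReal.ofReal (θ * x⁻¹ * Real.exp (-(b * x))) * gammaPDF θ b u := by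
  rw [scaledPalmWeight_eq hθ (show (fun _ : Fin 1 => x) ∈ posOrthant 1 from fun _ => hx)]
  simp only [Finset.univ_unique, Finset.prod_singleton, Finset.sum_singleton, pow_one]
  have hΓ := Real.Gamma_pos_of_pos hθ
  rcases lt_or_gt_of_ne hu with hu | hu
  · rw [gammaPDF_of_neg hu, indicator_of_notMem (by simp [hu.le]), mul_zero, mul_zero, mul_zero]
  · have hux : 0 < u + x := by positivity
    rw [gammaPDF_of_nonneg hu.le, gammaPDF_of_nonneg hux.le,
      indicator_of_mem (show u + x ∈ Ioi x from by simpa using hu),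
      show 1 - x / (u + x) = u / (u + x) by field_simp; ring,
      ← ENNReal.ofReal_mul (by positivity), ← ENNReal.ofReal_mul (by positivity),
      ← ENNReal.ofReal_mul (by positivity)]
    congr 1
    rw [Real.div_rpow hu.le hux.le, show -(b * (u + x)) = -(b * u) + -(b * x) by ring, Real.exp_add]
    have := (Real.rpow_pos_of_pos hux (θ - 1)).ne'
    field_simp

theorem meckeFormula_gamma {Ω : Type*} [MeasurableSpace Ω] {P : Measure Ω}
    [IsProbabilityMeasure P] {θ : ℝ} {X : Ω → RankedSimplex} {V : Ω → Ioi (0 : ℝ)} {ρ : Measure ℝ}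
    (hθ : 0 < θ) (hX : Measurable X) (hV : Measurable V)
    (hPD : P.map (fun ω => (X ω : ℕ → ℝ)) = poissonDirichlet θ hθ) (hindep : IndepFun V X P)
    (hρ : ρ = P.map (fun ω => (V ω : ℝ))) {b : ℝ} (hb : 0 < b) (hgamma : ρ = gammaMeasure θ b) :
    MeckeFormula P (fun ω => configOfSeq (liftSeq (V ω) (X ω)))
      ((volume.restrict (Ioi (0 : ℝ))).withDensity
        fun y => ENNReal.ofReal (θ * y⁻¹ * Real.exp (-(b * y)))) := by
  intro G hG
  have hL : ∀ ω, ∫⁻ x, G x (configOfSeq (liftSeq (V ω) (X ω)))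
      ∂(configOfSeq (liftSeq (V ω) (X ω))).1 =
      ∫⁻ z, G (z 0) (configOfSeq (liftSeq (V ω) (X ω))) ∂factorialMeasure 1 (liftSeq (V ω) (X ω)) :=
    fun ω => by
      rw [configOfSeq_eq]
      exact (lintegral_factorialMeasure_one (.of_summable (liftSeq (V ω) (X ω)).2.2.2.1)
        (f := fun x => G x (seqConfig (liftSeq (V ω) (X ω)))) (by fun_prop)).symm
  simp only [hL]
  rw [lintegral_factorialMeasure_liftSeq hθ hX hV hPD hindep hρ (k := 1)
    (G := fun z η => G (z 0) η) (by fun_prop)]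
  have hK : Measurable fun p : ℝ × ℝ => ∫⁻ ω, G p.1 (addAtoms (seqConfig (p.2 • (X ω : ℕ → ℝ)))
      fun _ : Fin 1 => p.1) ∂P := by fun_prop
  have hR : ∀ x, ∫⁻ ω, G x (addAtoms (configOfSeq (liftSeq (V ω) (X ω))) fun _ : Fin 1 => x) ∂P =
      ∫⁻ v, ∫⁻ ω, G x (addAtoms (seqConfig (v • (X ω : ℕ → ℝ))) fun _ : Fin 1 => x) ∂P ∂ρ := by
    intro x
    simp only [configOfSeq_eq, coe_liftSeq]
    exact lintegral_of_indepFun hX hV hindep hρ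
      (H := fun v y => G x (addAtoms (seqConfig (v • y)) fun _ : Fin 1 => x)) (by fun_prop)
  have hSF : SFinite ρ := by rw [hρ]; infer_instance
  have hg : Measurable (gammaPDF θ b) := (measurable_gammaPDFReal θ b).ennreal_ofReal
  simp only [hR]
  rw [lintegral_withDensity_eq_lintegral_mul _ (by fun_prop) (by fun_prop),
    ← lintegral_indicator measurableSet_Ioi]
  refine ((volume_preserving_funUnique (Fin 1) ℝ).symm.lintegral_comp (by fun_prop)).symm.trans ?_
  refine lintegral_congr fun x => ?_
  have hsymm : (MeasurableEquiv.funUnique (Fin 1) ℝ).symm x = fun _ => x := rfl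
  rw [hsymm]
  by_cases hx : 0 < x
  · rw [indicator_of_mem (show x ∈ Ioi 0 from hx), Pi.mul_apply]
    simp only [Finset.univ_unique, Finset.sum_singleton]
    have hKx : Measurable fun v : ℝ => ∫⁻ ω, G x (addAtoms (seqConfig (v • (X ω : ℕ → ℝ)))
      fun _ : Fin 1 => x) ∂P := hK.comp (measurable_const.prodMk measurable_id)
    rw [hgamma, gammaMeasure, lintegral_withDensity_eq_lintegral_mul _ hg (by fun_prop),
      lintegral_withDensity_eq_lintegral_mul _ hg hKx, ← lintegral_const_mul _ (hg.mul hKx)]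
    simp only [Pi.mul_apply]
    -- The translation `v = u + x` makes the mass `u` left after removing the point `x` the variable
    -- of integration; it is again gamma distributed.
    have hshift := lintegral_sub_right_eq_self (μ := (volume : Measure ℝ)) (fun u =>
      gammaPDF θ b (u + x) * (scaledPalmWeight θ (u + x) (fun _ : Fin 1 => x) *
        ∫⁻ ω, G x (addAtoms (seqConfig (u • (X ω : ℕ → ℝ))) fun _ : Fin 1 => x) ∂P)) x
    simp only [sub_add_cancel] at hshift
    rw [hshift]
    refine lintegral_congr_ae ?_
    filter_upwards [Measure.ae_ne volume (0 : ℝ)] with u hu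
    rw [← mul_assoc, gammaPDF_add_mul_scaledPalmWeight hθ hb hx hu, mul_assoc]
  · rw [indicator_of_notMem (show x ∉ Ioi 0 from hx)]
    have : (fun _ : Fin 1 => x) ∉ posOrthant 1 := fun h => hx (h 0)
    simp [scaledPalmWeight_eq_zero this]

/-! ### Assembly of the theorem -/

theorem lemma2p5 {Ω : Type*} [MeasurableSpace Ω] (P : Measure Ω) [IsProbabilityMeasure P]
    (θ : ℝ) (hθ : 0 < θ) (X : Ω → RankedSimplex) (V : Ω → Set.Ioi (0 : ℝ))
    (hX : Measurable X) (hV : Measurable V)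
    (hPD : P.map (fun ω => (X ω : ℕ → ℝ)) = poissonDirichlet θ hθ)
    (hindep : IndepFun V X P)
    (ρ : Measure ℝ) (hρ : ρ = P.map (fun ω => (V ω : ℝ)))
    (Z : Ω → RankedCone) (hZ : Z = fun ω => liftSeq (V ω) (X ω)) :
    Measurable (fun ω => configOfSeq (Z ω)) ∧
    (∀ k : ℕ, 1 ≤ k →
      -- the correlation functions
      IsCorrelationFunction P Z k (liftedCorrelation θ ρ) ∧
      (∀ᵐ z : Fin k → ℝ, z ∈ posOrthant k → liftedCorrelation θ ρ z < ∞) ∧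
      -- a version of the reduced Palm distributions satisfies the identity at every point
      (∃ Q : Kernel (Fin k → ℝ) PointConfig, IsMarkovKernel Q ∧ IsReducedPalm P Z k Q ∧
        ∀ z ∈ posOrthant k, 0 < ρ (Set.Ioi (∑ l, z l)) → liftedCorrelation θ ρ z < ∞ →
          SatisfiesPalmIdentity θ ρ P X z (Q z)) ∧
      -- at each such point the identity determines a probability measure uniquely
      (∀ z ∈ posOrthant k, 0 < ρ (Set.Ioi (∑ l, z l)) → liftedCorrelation θ ρ z < ∞ →
        ∀ Q₁ Q₂ : Measure PointConfig, IsProbabilityMeasure Q₁ → IsProbabilityMeasure Q₂ →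
          SatisfiesPalmIdentity θ ρ P X z Q₁ → SatisfiesPalmIdentity θ ρ P X z Q₂ → Q₁ = Q₂) ∧
      -- the identity characterizes the reduced Palm distributions
      (∀ Q : Kernel (Fin k → ℝ) PointConfig, IsMarkovKernel Q →
        (IsReducedPalm P Z k Q ↔
          ∀ᵐ z ∂(correlationMeasure P Z k), SatisfiesPalmIdentity θ ρ P X z (Q z)))) ∧
    -- the gamma case
    (∀ b : ℝ, 0 < b → ρ = gammaMeasure θ b →
      IsPoissonProcess P (fun ω => configOfSeq (Z ω))
        ((volume.restrict (Set.Ioi (0 : ℝ))).withDensity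
          fun y => ENNReal.ofReal (θ * y⁻¹ * Real.exp (-(b * y))))) := by
  subst hZ
  have hprob : IsProbabilityMeasure ρ := by
    rw [hρ]; exact Measure.isProbabilityMeasure_map (by fun_prop)
  have hZm : Measurable fun ω => configOfSeq (liftSeq (V ω) (X ω)) := by
    simp only [configOfSeq_eq, coe_liftSeq]
    fun_prop
  refine ⟨hZm, fun k _ => ?_, fun b hb hgamma => ?_⟩
  · have hσ := sigmaFinite_correlationMeasure hθ hX hV hPD hindep hρ k
    have hreg := ae_mem_palmRegular hθ hX hV hPD hindep hρ k
    have hmarkov : IsMarkovKernel (palmKernel θ ρ P hX k) :=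
      ⟨isProbabilityMeasure_palmVersion hθ hX⟩
    have hpalm := isReducedPalm_palmKernel hθ hX hV hPD hindep hρ k
    refine ⟨⟨measurable_liftedCorrelation, correlationMeasure_liftSeq hθ hX hV hPD hindep hρ k⟩,
      ae_liftedCorrelation_lt_top hθ hX hPD (ae_pos_of_map hV hρ) k,
      ⟨palmKernel θ ρ P hX k, hmarkov, hpalm, fun z hz hpos hfin =>
        satisfiesPalmIdentity_palmVersion hθ hX (mem_palmRegular hθ hz hpos hfin)⟩,
      fun z _ _ _ Q₁ Q₂ _ _ h₁ h₂ => h₁.eq h₂, fun Q _ => ⟨fun hQ => ?_, fun hQ => ?_⟩⟩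
    -- A reduced Palm kernel agrees almost everywhere with the explicit one, which satisfies the
    -- identity. Conversely, the identity forces `Q z` to be the explicit law almost everywhere.
    · filter_upwards [hQ.ae_eq hpalm, hreg] with z hz hzr
      rw [hz]
      exact satisfiesPalmIdentity_palmVersion hθ hX hzr
    · intro G hG
      rw [hpalm G hG]
      refine lintegral_congr_ae ?_
      filter_upwards [hQ, hreg] with z hz hzr
      have : Q z = palmKernel θ ρ P hX k z :=
        SatisfiesPalmIdentity.eq hz (satisfiesPalmIdentity_palmVersion hθ hX hzr)
      rw [this]
  · refine (meckeFormula_gamma hθ hX hV hPD hindep hρ hb hgamma).isPoisson hZm ?_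
    refine (withDensity_absolutelyContinuous _ _).ae_le ?_
    exact ae_restrict_mem measurableSet_Ioi
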